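/- Let $M$ be a smooth paracompact (Hausdorff) manifold of dimension $n\ge 3$, $\tau:T^\circ M\to M$ its tangent bundle with the zero section removed, $(x^i,y^i)$ the canonical coordinates on $TM$ induced by coordinates $(x^i)$ on $M$, and $\Delta=y^i\partial/\partial y^i$ the Liouville field. A \emph{spray} is a smooth vector field $\Gamma=y^i\frac{\partial}{\partial x^i}-2\Gamma^i\frac{\partial}{\partial y^i}$ on $T^\circ M$ with $\tau_*\Gamma_{(x,y)}=y$ and $[\Delta,\Gamma]=\Gamma$. Sprays $\Gamma,\tilde\Gamma$ are \emph{projectively equivalent} if $\tilde\Gamma=\Gamma-2P\Delta$ for a smooth function $P$ on $T^\circ M$ with $\Delta(P)=P$; the \emph{projective class} of $\Gamma$ is the set of all sprays projectively equivalent to it. With $\rho(x,y)=(x,-y)$, $\Gamma$ is \emph{reversible} if it is projectively equivalent to $-\rho_*\Gamma$. A \emph{Finsler function} is a smooth, positive function $F$ on $T^\circ M$ that is positively homogeneous of degree $1$ in $y$ and for which $g_{ij}=F\frac{\partial^2F}{\partial y^i\partial y^j}+\frac{\partial F}{\partial y^i}\frac{\partial F}{\partial y^j}$ is positive definite; it is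 \emph{absolutely homogeneous} if $F(ky)=|k|F(y)$ for all $k\in\mathbb R$ (with $F(0)=0$). Its \emph{geodesic class} is the set of all sprays $\Gamma$ that satisfy the Euler--Lagrange equations $\Gamma\left(\frac{\partial F}{\partial y^i}\right)-\frac{\partial F}{\partial x^i}=0$. For a spray $\Gamma$ put $\Gamma^i_j=\partial\Gamma^i/\partial y^j$, $H_i=\frac{\partial}{\partial x^i}-\Gamma^j_i\frac{\partial}{\partial y^j}$, define $R^j_i$ by $[\Gamma,H_i]=\Gamma^j_iH_j+R^j_i\frac{\partial}{\partial y^j}$, and let $W^i_j=R^i_j-R\,\delta^i_j-\rho_jy^i$ be the Weyl curvature, where $R=\frac1{n-1}R^k_k$ and $\rho_j=\frac1{n+1}\left(\frac{\partial R^k_j}{\partial y^k}-\frac{\partial R}{\partial y^j}\right)$. For a smooth type $(0,2)$ tensor field $h=(h_{ij}(x,y))$ along $\tau$ put $(\nabla h)_{ij}=\Gamma(h_{ij})-\Gamma^k_ih_{kj}-\Gamma^k_jh_{ik}$. Call $h$ a \emph{multiplier for $\Gamma$} if everywhere on $T^\circ M$, in all coordinates, $$h_{ji}=h_{ij},\qquad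 h_{ij}y^j=0,\qquad \frac{\partial h_{ij}}{\partial y^k}=\frac{\partial h_{ik}}{\partial y^j},\qquad (\nabla h)_{ij}=0,\qquad h_{ik}W^k_j=h_{jk}W^k_i,$$ and \emph{positive quasi-definite} if for all $(x,y)\in T^\circ M$ and $v\in T_xM$ one has $h_{ij}(x,y)v^iv^j\ge0$, with equality only if $v$ is a scalar multiple of $y$. \textbf{Theorem.} Let $\Gamma$ be a reversible spray on $T^\circ M$. Then the following are equivalent: (1) the projective class of $\Gamma$ is the geodesic class of a globally defined, absolutely homogeneous Finsler function on $T^\circ M$; (2) there is a positive quasi-definite tensor field $h$ along $\tau$ that is a multiplier for some spray in the projective class of $\Gamma$; (3) there is a positive quasi-definite tensor field $h$ along $\tau$ that is a multiplier for every spray in the projective class of $\Gamma$. (In particular, no cohomological condition on $M$ is needed.) -/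

import Mathlib

open scoped Manifold ContDiff

noncomputable section

namespace ProjFinsler

/-- The coordinate space `ℝⁿ`. -/
abbrev Coord (n : ℕ) : Type := EuclideanSpace ℝ (Fin n)

/-- Coordinate basis vectors of `ℝⁿ`. -/
def stdVec {n : ℕ} (i : Fin n) : Coord n := EuclideanSpace.single i 1

/-- `∂f/∂xⁱ` for a function `f` of the coordinates `(x, y)`. -/
def dx {n : ℕ} (i : Fin n) (f : Coord n × Coord n → ℝ) (p : Coord n × Coord n) : ℝ :=
  fderiv ℝ f p (stdVec i, 0)

/-- `∂f/∂yⁱ` for a function `f` of the coordinates `(x, y)`. -/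
def dy {n : ℕ} (i : Fin n) (f : Coord n × Coord n → ℝ) (p : Coord n × Coord n) : ℝ :=
  fderiv ℝ f p (0, stdVec i)

section Manifold

variable {n : ℕ} {M : Type*} [TopologicalSpace M] [ChartedSpace (Coord n) M]
  [IsManifold (𝓡 n) ∞ M]

/-- `T°M`: the tangent bundle with its zero section removed, as an open subset of `TM`. Objects on
`T°M` are represented by total functions on `TM` about which only the restriction to `T°M` is
ever used. -/
def slit (n : ℕ) (M : Type*) [TopologicalSpace M] [ChartedSpace (Coord n) M]
    [IsManifold (𝓡 n) ∞ M] : Set (TangentBundle (𝓡 n) M) :=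
  {v | v.snd ≠ 0}

/-- The set of all (maximal-atlas) smooth charts of `M`. -/
abbrev charts (n : ℕ) (M : Type*) [TopologicalSpace M] [ChartedSpace (Coord n) M] :
    Set (OpenPartialHomeomorph M (Coord n)) :=
  IsManifold.maximalAtlas (𝓡 n) ∞ M

/-- The coordinate domain of `T°U`, for a chart with domain `U`: pairs `(x, y)` with `y ≠ 0`. -/
def slitDomain (e : OpenPartialHomeomorph M (Coord n)) : Set (Coord n × Coord n) :=
  {p | p.1 ∈ e.target ∧ p.2 ≠ 0}

/-- The induced parametrization of `TU`, taking canonical coordinates `(x, y)` to the tangent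
vector `yⁱ ∂/∂xⁱ` at the point with coordinates `x`. -/
def param (e : OpenPartialHomeomorph M (Coord n)) (p : Coord n × Coord n) :
    TangentBundle (𝓡 n) M :=
  ⟨e.symm p.1, mfderiv 𝓘(ℝ, Coord n) (𝓡 n) e.symm p.1 p.2⟩

/-- Coordinate representation of a function on the tangent bundle. -/
def localFun (e : OpenPartialHomeomorph M (Coord n)) (F : TangentBundle (𝓡 n) M → ℝ) :
    Coord n × Coord n → ℝ :=
  fun p => F (param e p)

/-! ### Sprays -/

/-- Vector fields on the tangent bundle manifold (no smoothness included). -/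
abbrev TMField (n : ℕ) (M : Type*) [TopologicalSpace M] [ChartedSpace (Coord n) M]
    [IsManifold (𝓡 n) ∞ M] :=
  (v : TangentBundle (𝓡 n) M) → TangentSpace (𝓡 n).tangent v

/-- The Liouville field `Δ`: at `v = (x, y)` it is the vertical lift of `y`, that is the derivative
at `y`, in the direction `y`, of the inclusion of the fibre `T_xM` into `TM`. -/
def liouville (n : ℕ) (M : Type*) [TopologicalSpace M] [ChartedSpace (Coord n) M]
    [IsManifold (𝓡 n) ∞ M] : TMField n M := fun v =>
  mfderiv 𝓘(ℝ, Coord n) (𝓡 n).tangent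
    (fun w : Coord n => (⟨v.proj, w⟩ : TangentBundle (𝓡 n) M)) v.snd v.snd

/-- A spray: a smooth vector field `Γ` on `T°M` with `τ_* Γ_{(x,y)} = y` and `[Δ, Γ] = Γ`. -/
structure IsSpray (Γ : TMField n M) : Prop where
  smooth : ContMDiffOn (𝓡 n).tangent (𝓡 n).tangent.tangent ∞
    (fun v => (⟨v, Γ v⟩ : TangentBundle (𝓡 n).tangent (TangentBundle (𝓡 n) M))) (slit n M)
  proj : ∀ v ∈ slit n M,
    mfderiv (𝓡 n).tangent (𝓡 n) (Bundle.TotalSpace.proj : TangentBundle (𝓡 n) M → M) v (Γ v)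
      = v.snd
  bracket : ∀ v ∈ slit n M,
    VectorField.mlieBracket (𝓡 n).tangent (liouville n M) Γ v = Γ v

/-- Projective equivalence: `Γ' = Γ - 2PΔ` on `T°M` for a function `P` on `T°M` with
`Δ(P) = P`. -/
def ProjEquiv (Γ Γ' : TMField n M) : Prop :=
  ∃ P : TangentBundle (𝓡 n) M → ℝ,
    ContMDiffOn (𝓡 n).tangent 𝓘(ℝ, ℝ) ∞ P (slit n M) ∧
    (∀ v ∈ slit n M, mfderiv (𝓡 n).tangent 𝓘(ℝ, ℝ) P v (liouville n M v) = P v) ∧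
    ∀ v ∈ slit n M, Γ' v = Γ v - (2 * P v) • liouville n M v

/-- The projective class of a spray. -/
def projClass (Γ : TMField n M) : Set (TMField n M) :=
  {Γ' | IsSpray Γ' ∧ ProjEquiv Γ Γ'}

/-- The reflection `ρ : (x, y) ↦ (x, -y)`. -/
def reflection (v : TangentBundle (𝓡 n) M) : TangentBundle (𝓡 n) M :=
  ⟨v.proj, -v.snd⟩

/-- The reverse `-ρ_* Γ`. Since `ρ` is an involution, the push-forward along `ρ` is the
pull-back along `ρ`. -/
def reverse (Γ : TMField n M) : TMField n M := fun v =>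
  -VectorField.mpullback (𝓡 n).tangent (𝓡 n).tangent
    (reflection : TangentBundle (𝓡 n) M → TangentBundle (𝓡 n) M) Γ v

/-- A spray is reversible if it is projectively equivalent to its reverse. -/
def IsReversible (Γ : TMField n M) : Prop := ProjEquiv Γ (reverse Γ)

/-! ### Coordinate expressions attached to a spray -/

/-- The vector field in canonical coordinates, as an `ℝⁿ × ℝⁿ`-valued function of `(x, y)`. -/
def localField (e : OpenPartialHomeomorph M (Coord n)) (Γ : TMField n M) :
    Coord n × Coord n → Coord n × Coord n :=
  fun p => VectorField.mpullback 𝓘(ℝ, Coord n × Coord n) (𝓡 n).tangent (param e) Γ p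

/-- `Γⁱ`, where `Γ = yⁱ ∂/∂xⁱ - 2 Γⁱ ∂/∂yⁱ`. -/
def coeff (e : OpenPartialHomeomorph M (Coord n)) (Γ : TMField n M) (i : Fin n) :
    Coord n × Coord n → ℝ :=
  fun p => -(1 / 2) * (localField e Γ p).2 i

/-- `Γⁱⱼ = ∂Γⁱ/∂yʲ`. -/
def conn (e : OpenPartialHomeomorph M (Coord n)) (Γ : TMField n M) (i j : Fin n) :
    Coord n × Coord n → ℝ :=
  dy j (coeff e Γ i)

/-- `Hᵢ = ∂/∂xⁱ - Γʲᵢ ∂/∂yʲ`. -/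
def horiz (e : OpenPartialHomeomorph M (Coord n)) (Γ : TMField n M) (i : Fin n) :
    Coord n × Coord n → Coord n × Coord n :=
  fun p => (stdVec i, -∑ j, conn e Γ j i p • stdVec j)

/-- The Riemann curvature (Jacobi endomorphism) `Rʲᵢ`, defined by
`[Γ, Hᵢ] = Γᵏᵢ Hₖ + Rʲᵢ ∂/∂yʲ`. -/
def riemann (e : OpenPartialHomeomorph M (Coord n)) (Γ : TMField n M) (j i : Fin n) :
    Coord n × Coord n → ℝ :=
  fun p => (VectorField.lieBracket ℝ (localField e Γ) (horiz e Γ i) p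
    - ∑ k, conn e Γ k i p • horiz e Γ k p).2 j

/-- `R = Rᵏₖ / (n - 1)`. -/
def riemannTrace (e : OpenPartialHomeomorph M (Coord n)) (Γ : TMField n M) :
    Coord n × Coord n → ℝ :=
  fun p => 1 / ((n : ℝ) - 1) * ∑ k, riemann e Γ k k p

/-- `ρⱼ = (∂Rᵏⱼ/∂yᵏ - ∂R/∂yʲ) / (n + 1)`. -/
def rhoForm (e : OpenPartialHomeomorph M (Coord n)) (Γ : TMField n M) (j : Fin n) :
    Coord n × Coord n → ℝ :=
  fun p => 1 / ((n : ℝ) + 1) * (∑ k, dy k (riemann e Γ k j) p - dy j (riemannTrace e Γ) p)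

/-- The Weyl curvature `Wⁱⱼ = Rⁱⱼ - R δⁱⱼ - ρⱼ yⁱ`. -/
def weyl (e : OpenPartialHomeomorph M (Coord n)) (Γ : TMField n M) (i j : Fin n) :
    Coord n × Coord n → ℝ :=
  fun p => riemann e Γ i j p - riemannTrace e Γ p * (if i = j then 1 else 0)
    - rhoForm e Γ j p * p.2 i

/-! ### Finsler functions and their geodesic classes -/

/-- `gᵢⱼ = F ∂²F/∂yⁱ∂yʲ + ∂F/∂yⁱ ∂F/∂yʲ`. -/
def fundTensor (e : OpenPartialHomeomorph M (Coord n)) (F : TangentBundle (𝓡 n) M → ℝ)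
    (i j : Fin n) : Coord n × Coord n → ℝ :=
  fun p => localFun e F p * dy i (dy j (localFun e F)) p
    + dy i (localFun e F) p * dy j (localFun e F) p

/-- A Finsler function: smooth and positive on `T°M`, positively homogeneous of degree one, and
strongly convex. -/
structure IsFinsler (F : TangentBundle (𝓡 n) M → ℝ) : Prop where
  smooth : ContMDiffOn (𝓡 n).tangent 𝓘(ℝ, ℝ) ∞ F (slit n M)
  pos : ∀ v ∈ slit n M, 0 < F v
  homog : ∀ v ∈ slit n M, ∀ k : ℝ, 0 < k → F ⟨v.proj, k • v.snd⟩ = k * F v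
  convex : ∀ e ∈ charts n M, ∀ p ∈ slitDomain e, ∀ u : Fin n → ℝ, u ≠ 0 →
    0 < ∑ i, ∑ j, fundTensor e F i j p * u i * u j

/-- Absolute homogeneity: `F(ky) = |k| F(y)` for all real `k`. -/
def IsAbsHomogeneous (F : TangentBundle (𝓡 n) M → ℝ) : Prop :=
  ∀ v ∈ slit n M, ∀ k : ℝ, F ⟨v.proj, k • v.snd⟩ = |k| * F v

/-- The Euler-Lagrange equations `Γ(∂F/∂yⁱ) - ∂F/∂xⁱ = 0`, in every chart. -/
def EulerLagrange (F : TangentBundle (𝓡 n) M → ℝ) (Γ : TMField n M) : Prop :=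
  ∀ e ∈ charts n M, ∀ p ∈ slitDomain e, ∀ i : Fin n,
    fderiv ℝ (dy i (localFun e F)) p (localField e Γ p) - dx i (localFun e F) p = 0

/-- The geodesic class of `F`: all sprays that satisfy the Euler-Lagrange equations of `F`. -/
def geodesicClass (F : TangentBundle (𝓡 n) M → ℝ) : Set (TMField n M) :=
  {Γ | IsSpray Γ ∧ EulerLagrange F Γ}

/-! ### Multipliers -/

/-- Type `(0,2)` tensors along the tangent bundle projection (no smoothness included). -/
abbrev Tensor02 (n : ℕ) (M : Type*) [TopologicalSpace M] [ChartedSpace (Coord n) M]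
    [IsManifold (𝓡 n) ∞ M] :=
  (v : TangentBundle (𝓡 n) M) → LinearMap.BilinForm ℝ (TangentSpace (𝓡 n) v.proj)

/-- Components `hᵢⱼ(x, y) = h_{(x,y)}(∂/∂xⁱ, ∂/∂xʲ)`. -/
def comp (e : OpenPartialHomeomorph M (Coord n)) (h : Tensor02 n M) (i j : Fin n) :
    Coord n × Coord n → ℝ :=
  fun p => h (param e p)
    (mfderiv 𝓘(ℝ, Coord n) (𝓡 n) e.symm p.1 (stdVec i))
    (mfderiv 𝓘(ℝ, Coord n) (𝓡 n) e.symm p.1 (stdVec j))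

/-- The dynamical covariant derivative `(∇h)ᵢⱼ = Γ(hᵢⱼ) - Γᵏᵢ hₖⱼ - Γᵏⱼ hᵢₖ`. -/
def nabla (e : OpenPartialHomeomorph M (Coord n)) (Γ : TMField n M) (h : Tensor02 n M)
    (i j : Fin n) : Coord n × Coord n → ℝ :=
  fun p => fderiv ℝ (comp e h i j) p (localField e Γ p)
    - ∑ k, conn e Γ k i p * comp e h k j p - ∑ k, conn e Γ k j p * comp e h i k p

/-- The Helmholtz-like conditions on a (smooth) tensor `h` on `T°M`, relative to the spray `Γ`:
`hⱼᵢ = hᵢⱼ`, `hᵢⱼ yʲ = 0`, `∂hᵢⱼ/∂yᵏ = ∂hᵢₖ/∂yʲ`, `(∇h)ᵢⱼ = 0`, `hᵢₖ Wᵏⱼ = hⱼₖ Wᵏᵢ`. -/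
structure IsMultiplier (Γ : TMField n M) (h : Tensor02 n M) : Prop where
  smooth : ∀ e ∈ charts n M, ∀ i j, ContDiffOn ℝ ∞ (comp e h i j) (slitDomain e)
  symm : ∀ e ∈ charts n M, ∀ p ∈ slitDomain e, ∀ i j, comp e h j i p = comp e h i j p
  radial : ∀ e ∈ charts n M, ∀ p ∈ slitDomain e, ∀ i, ∑ j, comp e h i j p * p.2 j = 0
  closed : ∀ e ∈ charts n M, ∀ p ∈ slitDomain e, ∀ i j k,
    dy k (comp e h i j) p = dy j (comp e h i k) p
  parallel : ∀ e ∈ charts n M, ∀ p ∈ slitDomain e, ∀ i j, nabla e Γ h i j p = 0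
  weyl_symm : ∀ e ∈ charts n M, ∀ p ∈ slitDomain e, ∀ i j,
    ∑ k, comp e h i k p * weyl e Γ k j p = ∑ k, comp e h j k p * weyl e Γ k i p

/-- Positive quasi-definiteness: `h_{(x,y)}(u, u) ≥ 0` with equality only if `u` is a scalar
multiple of `y`. -/
def IsPosQuasiDef (h : Tensor02 n M) : Prop :=
  ∀ v ∈ slit n M, ∀ u : TangentSpace (𝓡 n) v.proj,
    0 ≤ h v u u ∧ (h v u u = 0 → ∃ k : ℝ, u = k • v.snd)

end Manifold

end ProjFinsler

end

/-!
The theorem is proved by the cycle (1) ⇒ (3) ⇒ (2) ⇒ (1); the middle implication is trivial.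

*From a Finsler function to a multiplier.* The multiplier is the fibre Hessian `h` of `F`
(`fibreHessian`), which is quasi-definite because `F h = g` on the kernel of the fibre derivative
of `F`. Write `Eᵢ = Γ(∂F/∂yⁱ) - ∂F/∂xⁱ`. The fibre derivative `∂Eᵢ/∂yʲ` has symmetric part `(∇h)ᵢⱼ`
(`dy_lEuler_add`), and its skew part says that `Hⱼ(∂F/∂yⁱ)` is symmetric in `i, j`. Differentiating
the latter along `Γ` and inserting the bracket `[Γ, Hⱼ]` shows that `hᵢₖRᵏⱼ` is symmetric
(`hessian_riemann_symm`); the remaining terms of the Weyl tensor do not affect the symmetry because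
`h` is symmetric and annihilates `y`.

*From a multiplier to a Finsler function.* On each punctured tangent space, which is simply
connected as `n ≥ 3`, the form `hᵢⱼdyʲ` is closed. Instead of an arbitrary potential one takes the
even one, which is unique, so that the local potentials agree and no cohomological obstruction
appears. It has an explicit formula: for `w` independent of `y` and
`γ(t) = cos t · y + sin t · w`,
`F(x, y) = ∫₀^π sin t · h_γ(γ', γ') dt`.
This is `yⁱΘᵢ`, where `Θᵢ` is the line integral of `hᵢⱼdyʲ` along the half-ellipse from `-y` to `y`.
The first variation of `Θᵢ` only sees the end points (`fderiv_angularForm`), so `Θᵢ` does not depend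
on `w` (the vectors independent of `y` form a connected set, `angularForm_eq`) and
`∂Θᵢ/∂yʲ = hᵢⱼ(x, y) + hᵢⱼ(x, -y)`. Hence `F` is smooth, positive, even, homogeneous, with
quasi-definite fibre Hessian.

For the Euler-Lagrange equations, reversibility makes `h(x, -y)` parallel along with `h(x, y)`
(`lnabla_comp_flip`), so `∂Eᵢ/∂yʲ` is skew. A skew `∂Eᵢ/∂yʲ` has vanishing fibre derivative, so it is
constant on the fibres; `E` is even by reversibility, so `∂Eᵢ/∂yʲ` is also odd, hence zero, and then
`yⁱEᵢ = 0` forces `E = 0` (`lEuler_eq_zero`). Finally, two sprays satisfying the equations differ by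
a vertical field in the kernel of the Hessian, that is by a multiple of the Liouville field
(`projEquiv_of_eulerLagrange`).
-/

noncomputable section

open Set Filter Topology

set_option linter.unusedSectionVars false

namespace ProjFinsler

/-! ### Smooth dependence of integrals on parameters -/

section Parametric

variable {Z G : Type} [NormedAddCommGroup Z] [NormedSpace ℝ Z]
  [NormedAddCommGroup G] [NormedSpace ℝ G]

lemma contDiffOn_fderiv_param {Ω : Set Z} (hΩ : IsOpen Ω) {f : Z → ℝ → G}
    (hf : ContDiffOn ℝ ∞ (fun q : Z × ℝ => f q.1 q.2) (Ω ×ˢ univ)) :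
    ContDiffOn ℝ ∞ (fun q : Z × ℝ => fderiv ℝ (fun z => f z q.2) q.1) (Ω ×ˢ univ) := by
  have ho : IsOpen (Ω ×ˢ (univ : Set ℝ)) := hΩ.prod isOpen_univ
  have h1 : ContDiffOn ℝ ∞ (fun q : Z × ℝ =>
      (fderiv ℝ (fun q : Z × ℝ => f q.1 q.2) q).comp (ContinuousLinearMap.inl ℝ Z ℝ))
      (Ω ×ˢ univ) :=
    (hf.fderiv_of_isOpen ho le_rfl).clm_comp contDiffOn_const
  refine h1.congr fun q hq => ?_
  have hd : DifferentiableAt ℝ (fun q : Z × ℝ => f q.1 q.2) (q.1, q.2) :=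
    (hf.contDiffAt (ho.mem_nhds hq)).differentiableAt (by simp)
  exact (hd.hasFDerivAt.comp (f := fun z => (z, q.2)) q.1
    (hasFDerivAt_prodMk_left q.1 q.2)).fderiv

lemma hasFDerivAt_parametric_integral [ProperSpace Z] {Ω : Set Z} (hΩ : IsOpen Ω) {f : Z → ℝ → G}
    (hf : ContDiffOn ℝ ∞ (fun q : Z × ℝ => f q.1 q.2) (Ω ×ˢ univ)) (a b : ℝ) {z : Z}
    (hz : z ∈ Ω) :
    HasFDerivAt (fun z => ∫ t in a..b, f z t) (∫ t in a..b, fderiv ℝ (fun z => f z t) z) z := by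
  have ho : IsOpen (Ω ×ˢ (univ : Set ℝ)) := hΩ.prod isOpen_univ
  have hc : ∀ x ∈ Ω, Continuous (f x) := fun x hx => by
    have := hf.continuousOn.comp_continuous (f := fun t : ℝ => (x, t)) (by fun_prop)
      (fun t => ⟨hx, mem_univ t⟩)
    exact this
  have hf' := (contDiffOn_fderiv_param hΩ hf).continuousOn
  have hc' : Continuous fun t => fderiv ℝ (fun z => f z t) z := by
    have := hf'.comp_continuous (f := fun t : ℝ => (z, t)) (by fun_prop)
      (fun t => ⟨hz, mem_univ t⟩)
    exact this
  obtain ⟨K, hKc, hK, hKΩ⟩ := exists_compact_subset hΩ hz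
  rw [mem_interior_iff_mem_nhds] at hK
  obtain ⟨C, hC⟩ := (hKc.prod (isCompact_uIcc (a := a) (b := b))).exists_bound_of_continuousOn
    (hf'.mono (prod_mono hKΩ (subset_univ _)))
  refine intervalIntegral.hasFDerivAt_integral_of_dominated_of_fderiv_le
    (F' := fun x t => fderiv ℝ (fun z => f z t) x) (bound := fun _ => C) hK ?_
    ((hc z hz).intervalIntegrable _ _) hc'.aestronglyMeasurable ?_ intervalIntegrable_const ?_
  · filter_upwards [hΩ.mem_nhds hz] with x hx using (hc x hx).aestronglyMeasurable
  · exact MeasureTheory.ae_of_all _ fun t ht x hx => hC (x, t) ⟨hx, uIoc_subset_uIcc ht⟩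
  · refine MeasureTheory.ae_of_all _ fun t ht x hx => DifferentiableAt.hasFDerivAt ?_
    have hd : DifferentiableAt ℝ (fun q : Z × ℝ => f q.1 q.2) (x, t) :=
      (hf.contDiffAt (ho.mem_nhds ⟨hKΩ hx, mem_univ t⟩)).differentiableAt (by simp)
    exact hd.comp x (f := fun z => (z, t)) (by fun_prop)

end Parametric

lemma contDiffOn_parametric_integral_nat {Z : Type} [NormedAddCommGroup Z] [NormedSpace ℝ Z]
    [ProperSpace Z] {Ω : Set Z} (hΩ : IsOpen Ω) (a b : ℝ) (m : ℕ) :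
    ∀ {G : Type} [NormedAddCommGroup G] [NormedSpace ℝ G] {f : Z → ℝ → G},
      ContDiffOn ℝ ∞ (fun q : Z × ℝ => f q.1 q.2) (Ω ×ˢ univ) →
      ContDiffOn ℝ m (fun z => ∫ t in a..b, f z t) Ω := by
  induction m with
  | zero =>
    intro G _ _ f hf
    exact contDiffOn_zero.2 fun z hz =>
      (hasFDerivAt_parametric_integral hΩ hf a b hz).continuousAt.continuousWithinAt
  | succ m ih =>
    intro G _ _ f hf
    push_cast
    refine (contDiffOn_succ_iff_fderiv_of_isOpen hΩ).2 ⟨fun z hz =>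
      (hasFDerivAt_parametric_integral hΩ hf a b hz).differentiableAt.differentiableWithinAt,
      by simp, ?_⟩
    exact (ih (contDiffOn_fderiv_param hΩ hf)).congr fun z hz =>
      (hasFDerivAt_parametric_integral hΩ hf a b hz).fderiv

lemma contDiffOn_parametric_integral {Z G : Type} [NormedAddCommGroup Z] [NormedSpace ℝ Z]
    [ProperSpace Z] [NormedAddCommGroup G] [NormedSpace ℝ G] {Ω : Set Z} (hΩ : IsOpen Ω)
    {f : Z → ℝ → G} (hf : ContDiffOn ℝ ∞ (fun q : Z × ℝ => f q.1 q.2) (Ω ×ˢ univ)) (a b : ℝ) :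
    ContDiffOn ℝ ∞ (fun z => ∫ t in a..b, f z t) Ω :=
  contDiffOn_infty.2 fun m => contDiffOn_parametric_integral_nat hΩ a b m hf

/-! ### Canonical coordinates on the tangent bundle -/

section Coordinates

variable {n : ℕ} {M : Type*} [TopologicalSpace M] [ChartedSpace (Coord n) M]
  [IsManifold (𝓡 n) ∞ M]

lemma charts_mdifferentiable {e : OpenPartialHomeomorph M (Coord n)} (he : e ∈ charts n M) :
    e.MDifferentiable (𝓡 n) (𝓡 n) :=
  ⟨(contMDiffOn_of_mem_maximalAtlas he).mdifferentiableOn (by simp),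
    (contMDiffOn_symm_of_mem_maximalAtlas he).mdifferentiableOn (by simp)⟩

lemma contMDiff_mk_tangentBundle_coord :
    ContMDiff 𝓘(ℝ, Coord n × Coord n) (𝓡 n).tangent ∞
      (fun p : Coord n × Coord n => (⟨p.1, p.2⟩ : TangentBundle (𝓡 n) (Coord n))) := by
  intro p
  rw [Bundle.contMDiffAt_totalSpace]
  refine ⟨contDiff_fst.contMDiff p, ?_⟩
  simpa using contDiff_snd.contMDiff p

lemma contMDiffOn_param {e : OpenPartialHomeomorph M (Coord n)} (he : e ∈ charts n M) :
    ContMDiffOn 𝓘(ℝ, Coord n × Coord n) (𝓡 n).tangent ∞ (param e) (e.target ×ˢ univ) := by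
  have h := (contMDiffOn_symm_of_mem_maximalAtlas he).contMDiffOn_tangentMapWithin (m := ∞)
    (by simp) e.open_target.uniqueMDiffOn
  refine (h.comp contMDiff_mk_tangentBundle_coord.contMDiffOn
    (s := e.target ×ˢ univ) (fun p hp => hp.1)).congr fun p hp => ?_
  simp only [param, Function.comp, tangentMapWithin]
  rw [mfderivWithin_of_isOpen e.open_target hp.1]

/-- The coordinates `(x, y)` of a tangent vector in the canonical chart induced by `e`. -/
def coparam (e : OpenPartialHomeomorph M (Coord n)) (v : TangentBundle (𝓡 n) M) :
    Coord n × Coord n :=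
  (e v.proj, mfderiv (𝓡 n) 𝓘(ℝ, Coord n) e v.proj v.snd)

lemma contMDiffOn_coparam {e : OpenPartialHomeomorph M (Coord n)} (he : e ∈ charts n M) :
    ContMDiffOn (𝓡 n).tangent 𝓘(ℝ, Coord n × Coord n) ∞ (coparam e)
      (Bundle.TotalSpace.proj ⁻¹' e.source) := by
  have h := (contMDiffOn_of_mem_maximalAtlas he).contMDiffOn_tangentMapWithin (m := ∞)
    (by simp) e.open_source.uniqueMDiffOn
  have h1 : ContMDiffOn (𝓡 n).tangent 𝓘(ℝ, Coord n) ∞ (fun v : TangentBundle (𝓡 n) M => e v.proj)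
      (Bundle.TotalSpace.proj ⁻¹' e.source) :=
    (contMDiffOn_of_mem_maximalAtlas he).comp
      (Bundle.contMDiff_proj (TangentSpace (𝓡 n))).contMDiffOn (fun v hv => hv)
  have h2 := (contMDiff_snd_tangentBundle_modelSpace (Coord n) (𝓡 n) (n := ∞)).comp_contMDiffOn h
  refine (h1.prodMk_space h2).congr fun v hv => ?_
  simp only [coparam, Function.comp, tangentMapWithin]
  rw [mfderivWithin_of_isOpen e.open_source hv]

lemma coparam_param {e : OpenPartialHomeomorph M (Coord n)} (he : e ∈ charts n M)
    {p : Coord n × Coord n} (hp : p.1 ∈ e.target) : coparam e (param e p) = p := by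
  have h := (charts_mdifferentiable he).comp_symm_deriv hp
  refine Prod.ext (e.right_inv hp) ?_
  exact congrArg (fun L => L p.2) h

lemma param_coparam {e : OpenPartialHomeomorph M (Coord n)} (he : e ∈ charts n M)
    {v : TangentBundle (𝓡 n) M} (hv : v.proj ∈ e.source) : param e (coparam e v) = v := by
  obtain ⟨m, w⟩ := v
  have h := (charts_mdifferentiable he).symm_comp_deriv hv
  have h' : mfderiv 𝓘(ℝ, Coord n) (𝓡 n) e.symm (e m) (mfderiv (𝓡 n) 𝓘(ℝ, Coord n) e m w) = w :=
    congrArg (fun L => L w) h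
  have hm : e.symm (e m) = m := e.left_inv hv
  exact Bundle.TotalSpace.ext hm (heq_of_eq h')

lemma isOpen_slitDomain (e : OpenPartialHomeomorph M (Coord n)) : IsOpen (slitDomain e) :=
  (e.open_target.preimage continuous_fst).inter
    ((isOpen_compl_singleton (x := (0 : Coord n))).preimage continuous_snd)

lemma symm_mfderiv_injective {e : OpenPartialHomeomorph M (Coord n)} (he : e ∈ charts n M)
    {x : Coord n} (hx : x ∈ e.target) :
    Function.Injective (mfderiv 𝓘(ℝ, Coord n) (𝓡 n) e.symm x) :=
  (charts_mdifferentiable he).symm.mfderiv_injective hx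

lemma symm_mfderiv_surjective {e : OpenPartialHomeomorph M (Coord n)} (he : e ∈ charts n M)
    {x : Coord n} (hx : x ∈ e.target) :
    Function.Surjective (mfderiv 𝓘(ℝ, Coord n) (𝓡 n) e.symm x) :=
  (charts_mdifferentiable he).symm.mfderiv_surjective hx

lemma param_mem_slit {e : OpenPartialHomeomorph M (Coord n)} (he : e ∈ charts n M)
    {p : Coord n × Coord n} (hp : p ∈ slitDomain e) : param e p ∈ slit n M := by
  intro h
  exact hp.2 (symm_mfderiv_injective he hp.1 (h.trans (map_zero _).symm))

lemma coparam_mem_slitDomain {e : OpenPartialHomeomorph M (Coord n)} (he : e ∈ charts n M)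
    {v : TangentBundle (𝓡 n) M} (hv : v.proj ∈ e.source) (hs : v ∈ slit n M) :
    coparam e v ∈ slitDomain e :=
  ⟨e.map_source hv, fun h => hs ((charts_mdifferentiable he).mfderiv_injective hv
    (h.trans (map_zero _).symm))⟩

/-- Every nonzero tangent vector lies in a canonical chart. -/
lemma exists_chart_param {v : TangentBundle (𝓡 n) M} (hv : v ∈ slit n M) :
    ∃ e ∈ charts n M, ∃ p ∈ slitDomain e, v.proj ∈ e.source ∧ param e p = v := by
  have he : chartAt (Coord n) v.proj ∈ charts n M := IsManifold.chart_mem_maximalAtlas _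
  have hs := mem_chart_source (Coord n) v.proj
  exact ⟨_, he, _, coparam_mem_slitDomain he hs hv, hs, param_coparam he hs⟩

lemma isOpen_proj_preimage (e : OpenPartialHomeomorph M (Coord n)) :
    IsOpen ((Bundle.TotalSpace.proj : TangentBundle (𝓡 n) M → M) ⁻¹' e.source) :=
  e.open_source.preimage (FiberBundle.continuous_proj (Coord n) (TangentSpace (𝓡 n)))

lemma isOpen_slit : IsOpen (slit n M) := by
  rw [isOpen_iff_mem_nhds]
  intro v hv
  have he : chartAt (Coord n) v.proj ∈ charts n M := IsManifold.chart_mem_maximalAtlas _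
  have hs := mem_chart_source (Coord n) v.proj
  have hc := (contMDiffOn_coparam he).continuousOn.isOpen_inter_preimage
    (isOpen_proj_preimage (chartAt (Coord n) v.proj)) (isOpen_slitDomain (chartAt (Coord n) v.proj))
  refine mem_of_superset (hc.mem_nhds ⟨hs, coparam_mem_slitDomain he hs hv⟩) ?_
  rintro w ⟨hw, hw'⟩
  have := param_mem_slit he hw'
  rwa [param_coparam he hw] at this

lemma contMDiffAt_param {e : OpenPartialHomeomorph M (Coord n)} (he : e ∈ charts n M)
    {p : Coord n × Coord n} (hp : p.1 ∈ e.target) :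
    ContMDiffAt 𝓘(ℝ, Coord n × Coord n) (𝓡 n).tangent ∞ (param e) p :=
  (contMDiffOn_param he).contMDiffAt ((e.open_target.prod isOpen_univ).mem_nhds ⟨hp, mem_univ _⟩)

lemma contMDiffAt_coparam {e : OpenPartialHomeomorph M (Coord n)} (he : e ∈ charts n M)
    {v : TangentBundle (𝓡 n) M} (hv : v.proj ∈ e.source) :
    ContMDiffAt (𝓡 n).tangent 𝓘(ℝ, Coord n × Coord n) ∞ (coparam e) v :=
  (contMDiffOn_coparam he).contMDiffAt ((isOpen_proj_preimage e).mem_nhds hv)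

/-- A function is smooth on the slit tangent bundle iff all its coordinate representations are. -/
lemma contMDiffOn_slit_iff {F : TangentBundle (𝓡 n) M → ℝ} :
    ContMDiffOn (𝓡 n).tangent 𝓘(ℝ, ℝ) ∞ F (slit n M) ↔
      ∀ e ∈ charts n M, ContDiffOn ℝ ∞ (localFun e F) (slitDomain e) := by
  constructor
  · intro h e he
    rw [← contMDiffOn_iff_contDiffOn]
    exact h.comp ((contMDiffOn_param he).mono fun p hp => ⟨hp.1, mem_univ _⟩)
      fun p hp => param_mem_slit he hp
  · intro h v hv
    have he : chartAt (Coord n) v.proj ∈ charts n M := IsManifold.chart_mem_maximalAtlas _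
    have hs := mem_chart_source (Coord n) v.proj
    have h1 := ((h _ he).contDiffAt ((isOpen_slitDomain _).mem_nhds
      (coparam_mem_slitDomain he hs hv))).contMDiffAt
    have h2 : ContMDiffAt _ _ _ _ _ := h1.comp v (contMDiffAt_coparam he hs)
    refine (h2.congr_of_eventuallyEq ?_).contMDiffWithinAt
    filter_upwards [(isOpen_proj_preimage _).mem_nhds hs] with w hw
    simp only [Function.comp, localFun]
    rw [param_coparam he hw]

lemma mfderiv_coparam_comp_param {e : OpenPartialHomeomorph M (Coord n)} (he : e ∈ charts n M)
    {p : Coord n × Coord n} (hp : p.1 ∈ e.target) :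
    (mfderiv (𝓡 n).tangent 𝓘(ℝ, Coord n × Coord n) (coparam e) (param e p)).comp
      (mfderiv 𝓘(ℝ, Coord n × Coord n) (𝓡 n).tangent (param e) p)
      = ContinuousLinearMap.id ℝ _ := by
  have hv : (param e p).proj ∈ e.source := e.map_target hp
  have d1 := ((contMDiffAt_param he hp).mdifferentiableAt (by simp)).hasMFDerivAt
  have d2 := ((contMDiffAt_coparam he hv).mdifferentiableAt (by simp)).hasMFDerivAt
  have e1 : HasMFDerivAt 𝓘(ℝ, Coord n × Coord n) 𝓘(ℝ, Coord n × Coord n) (coparam e ∘ param e) p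
      (ContinuousLinearMap.id ℝ _) := by
    refine (hasMFDerivAt_id (M := Coord n × Coord n) p).congr_of_eventuallyEq ?_
    filter_upwards [(e.open_target.preimage continuous_fst).mem_nhds hp] with q hq
    exact coparam_param he hq
  exact hasMFDerivAt_unique (d2.comp p d1) e1

lemma mfderiv_param_comp_coparam {e : OpenPartialHomeomorph M (Coord n)} (he : e ∈ charts n M)
    {p : Coord n × Coord n} (hp : p.1 ∈ e.target) :
    (mfderiv 𝓘(ℝ, Coord n × Coord n) (𝓡 n).tangent (param e) p).comp
      (mfderiv (𝓡 n).tangent 𝓘(ℝ, Coord n × Coord n) (coparam e) (param e p))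
      = ContinuousLinearMap.id ℝ _ := by
  have hv : (param e p).proj ∈ e.source := e.map_target hp
  have d1 := ((contMDiffAt_param he hp).mdifferentiableAt (by simp)).hasMFDerivAt
  have d2 := ((contMDiffAt_coparam he hv).mdifferentiableAt (by simp)).hasMFDerivAt
  rw [show p = coparam e (param e p) from (coparam_param he hp).symm] at d1
  have h12 := d1.comp (param e p) d2
  rw [coparam_param he hp] at h12
  have e2 : HasMFDerivAt (𝓡 n).tangent (𝓡 n).tangent (param e ∘ coparam e) (param e p)
      (ContinuousLinearMap.id ℝ _) := by
    refine (hasMFDerivAt_id (M := TangentBundle (𝓡 n) M) (param e p)).congr_of_eventuallyEq ?_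
    filter_upwards [(isOpen_proj_preimage e).mem_nhds hv] with w hw
    exact param_coparam he hw
  exact hasMFDerivAt_unique h12 e2

lemma isInvertible_mfderiv_param {e : OpenPartialHomeomorph M (Coord n)} (he : e ∈ charts n M)
    {p : Coord n × Coord n} (hp : p.1 ∈ e.target) :
    (mfderiv 𝓘(ℝ, Coord n × Coord n) (𝓡 n).tangent (param e) p).IsInvertible :=
  .of_inverse (mfderiv_param_comp_coparam he hp) (mfderiv_coparam_comp_param he hp)

lemma isInvertible_mfderiv_coparam {e : OpenPartialHomeomorph M (Coord n)} (he : e ∈ charts n M)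
    {p : Coord n × Coord n} (hp : p.1 ∈ e.target) :
    (mfderiv (𝓡 n).tangent 𝓘(ℝ, Coord n × Coord n) (coparam e) (param e p)).IsInvertible :=
  .of_inverse (mfderiv_coparam_comp_param he hp) (mfderiv_param_comp_coparam he hp)

end Coordinates

/-! ### Sprays in canonical coordinates -/

section Sprays

variable {n : ℕ} {M : Type*} [TopologicalSpace M] [ChartedSpace (Coord n) M]
  [IsManifold (𝓡 n) ∞ M]

lemma mfderiv_param_localField {e : OpenPartialHomeomorph M (Coord n)} (he : e ∈ charts n M)
    (Γ : TMField n M) {p : Coord n × Coord n} (hp : p.1 ∈ e.target) :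
    mfderiv 𝓘(ℝ, Coord n × Coord n) (𝓡 n).tangent (param e) p (localField e Γ p)
      = Γ (param e p) :=
  (isInvertible_mfderiv_param he hp).self_apply_inverse _

lemma localField_eq_of_mfderiv_eq {e : OpenPartialHomeomorph M (Coord n)} (he : e ∈ charts n M)
    {Γ : TMField n M} {p u : Coord n × Coord n} (hp : p.1 ∈ e.target)
    (h : mfderiv 𝓘(ℝ, Coord n × Coord n) (𝓡 n).tangent (param e) p u = Γ (param e p)) :
    localField e Γ p = u := by
  have h1 := (isInvertible_mfderiv_param he hp).inverse_apply_self u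
  rw [h] at h1
  exact h1

lemma fderiv_localFun {e : OpenPartialHomeomorph M (Coord n)} (he : e ∈ charts n M)
    {F : TangentBundle (𝓡 n) M → ℝ}
    (hF : ContMDiffOn (𝓡 n).tangent 𝓘(ℝ, ℝ) ∞ F (slit n M)) {p : Coord n × Coord n}
    (hp : p ∈ slitDomain e) (Γ : TMField n M) :
    fderiv ℝ (localFun e F) p (localField e Γ p)
      = mfderiv (𝓡 n).tangent 𝓘(ℝ, ℝ) F (param e p) (Γ (param e p)) := by
  have d1 := ((contMDiffAt_param he hp.1).mdifferentiableAt (by simp)).hasMFDerivAt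
  have d2 := ((hF.contMDiffAt (isOpen_slit.mem_nhds (param_mem_slit he hp))).mdifferentiableAt
    (by simp)).hasMFDerivAt
  have h := d2.comp p d1
  rw [← mfderiv_param_localField he Γ hp.1, ← mfderiv_eq_fderiv]
  exact congrArg (fun L => L (localField e Γ p)) h.mfderiv

lemma localField_liouville {e : OpenPartialHomeomorph M (Coord n)} (he : e ∈ charts n M)
    {p : Coord n × Coord n} (hp : p.1 ∈ e.target) :
    localField e (liouville n M) p = (0, p.2) := by
  obtain ⟨x, y⟩ := p
  refine localField_eq_of_mfderiv_eq he hp ?_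
  have hs : e.symm x ∈ e.source := e.map_target hp
  let A : Coord n →L[ℝ] Coord n := mfderiv 𝓘(ℝ, Coord n) (𝓡 n) e.symm x
  let B : Coord n →L[ℝ] Coord n := mfderiv (𝓡 n) 𝓘(ℝ, Coord n) e (e.symm x)
  have hBA : ∀ w : Coord n, B (A w) = w := fun w =>
    congrArg (fun L => L w) ((charts_mdifferentiable he).comp_symm_deriv hp)
  have hAB : ∀ w : Coord n, A (B w) = w := fun w => by
    have h := (charts_mdifferentiable he).symm_comp_deriv hs
    rw [e.right_inv hp] at h
    exact congrArg (fun L => L w) h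
  have hmk : (fun w : Coord n => (⟨e.symm x, w⟩ : TangentBundle (𝓡 n) M))
      = param e ∘ fun w => (x, B w) := by
    funext w
    exact Bundle.TotalSpace.ext rfl (heq_of_eq (hAB w).symm)
  have hBw : HasMFDerivAt 𝓘(ℝ, Coord n) 𝓘(ℝ, Coord n × Coord n) (fun w => (x, B w)) (A y)
      ((ContinuousLinearMap.inr ℝ (Coord n) (Coord n)).comp B) :=
    ((hasFDerivAt_prodMk_right x (B (A y))).comp (f := B) (A y) B.hasFDerivAt).hasMFDerivAt
  have d1 : HasMFDerivAt 𝓘(ℝ, Coord n × Coord n) (𝓡 n).tangent (param e) (x, B (A y))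
      (mfderiv 𝓘(ℝ, Coord n × Coord n) (𝓡 n).tangent (param e) (x, B (A y))) :=
    ((contMDiffAt_param he (p := (x, B (A y))) hp).mdifferentiableAt (by simp)).hasMFDerivAt
  have h := (d1.comp (f := fun w => (x, B w)) (A y) hBw).mfderiv
  have h2 : liouville n M (param e (x, y)) =
      mfderiv 𝓘(ℝ, Coord n) (𝓡 n).tangent (param e ∘ fun w => (x, B w)) (A y) (A y) := by
    rw [← hmk]
    rfl
  rw [h2, h]
  change _ = mfderiv 𝓘(ℝ, Coord n × Coord n) (𝓡 n).tangent (param e) (x, B (A y))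
    ((0 : Coord n), B (A y))
  rw [hBA]

lemma localField_fst {e : OpenPartialHomeomorph M (Coord n)} (he : e ∈ charts n M)
    {Γ : TMField n M} (hΓ : IsSpray Γ) {p : Coord n × Coord n} (hp : p ∈ slitDomain e) :
    (localField e Γ p).1 = p.2 := by
  have d1 := ((contMDiffAt_param he hp.1).mdifferentiableAt (by simp)).hasMFDerivAt
  have d2 : HasMFDerivAt (𝓡 n).tangent (𝓡 n)
      (Bundle.TotalSpace.proj : TangentBundle (𝓡 n) M → M) (param e p) _ :=
    ((Bundle.contMDiff_proj (n := ∞) (TangentSpace (𝓡 n)) (param e p)).mdifferentiableAt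
      (by simp)).hasMFDerivAt
  have h := d2.comp p d1
  have d3 : HasMFDerivAt 𝓘(ℝ, Coord n) (𝓡 n) e.symm p.1 _ :=
    ((charts_mdifferentiable he).mdifferentiableAt_symm hp.1).hasMFDerivAt
  have d4 : HasMFDerivAt 𝓘(ℝ, Coord n × Coord n) 𝓘(ℝ, Coord n) (Prod.fst) p
      (ContinuousLinearMap.fst ℝ (Coord n) (Coord n)) := hasFDerivAt_fst.hasMFDerivAt
  have h' := d3.comp p d4
  have h3 := hasMFDerivAt_unique h h'
  have h4 := congrArg (fun L => L (localField e Γ p)) h3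
  refine symm_mfderiv_injective he hp.1 ?_
  refine h4.symm.trans ?_
  refine Eq.trans ?_ (hΓ.proj _ (param_mem_slit he hp))
  rw [← mfderiv_param_localField he Γ hp.1]
  rfl

lemma contDiffOn_localField {e : OpenPartialHomeomorph M (Coord n)} (he : e ∈ charts n M)
    {Γ : TMField n M} (hΓ : IsSpray Γ) : ContDiffOn ℝ ∞ (localField e Γ) (slitDomain e) := by
  intro p hp
  have h1 := hΓ.smooth.contMDiffAt (isOpen_slit.mem_nhds (param_mem_slit he hp))
  have h2 := ContMDiffAt.mpullback_vectorField_preimage h1 (contMDiffAt_param he hp.1)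
    (isInvertible_mfderiv_param he hp.1) (by simp)
  exact (contMDiffAt_vectorSpace_iff_contDiffAt.1 h2).contDiffWithinAt

lemma contMDiffAt_liouville {e : OpenPartialHomeomorph M (Coord n)} (he : e ∈ charts n M)
    {p : Coord n × Coord n} (hp : p.1 ∈ e.target) :
    ContMDiffAt (𝓡 n).tangent (𝓡 n).tangent.tangent ∞
      (fun v => (⟨v, liouville n M v⟩ :
        TangentBundle (𝓡 n).tangent (TangentBundle (𝓡 n) M))) (param e p) := by
  let V : (q : Coord n × Coord n) → TangentSpace 𝓘(ℝ, Coord n × Coord n) q :=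
    fun q => ((0 : Coord n), q.2)
  have hV : ContDiffAt ℝ ∞ (fun q : Coord n × Coord n => ((0 : Coord n), q.2))
      (coparam e (param e p)) := by fun_prop
  have hv : (param e p).proj ∈ e.source := e.map_target hp
  have h := ContMDiffAt.mpullback_vectorField_preimage
    ((contMDiffAt_vectorSpace_iff_contDiffAt (V := V)).2 hV)
    (contMDiffAt_coparam he hv) (isInvertible_mfderiv_coparam he hp) (by simp)
  refine h.congr_of_eventuallyEq ?_
  filter_upwards [(isOpen_proj_preimage e).mem_nhds hv] with v hv
  have hq : (coparam e v).1 ∈ e.target := e.map_source hv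
  refine congrArg (fun u => (⟨v, u⟩ : TangentBundle (𝓡 n).tangent (TangentBundle (𝓡 n) M))) ?_
  have h1 := (isInvertible_mfderiv_coparam he hq).inverse_apply_self
    (liouville n M (param e (coparam e v)))
  have h2 : mfderiv (𝓡 n).tangent 𝓘(ℝ, Coord n × Coord n) (coparam e) (param e (coparam e v))
      (liouville n M (param e (coparam e v))) = V (coparam e v) := by
    refine Eq.trans ?_ (localField_liouville he hq)
    rw [← mfderiv_param_localField he (liouville n M) hq]
    exact congrArg (fun L => L (localField e (liouville n M) (coparam e v)))
      (mfderiv_coparam_comp_param he hq)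
  rw [h2, param_coparam he hv] at h1
  exact h1.symm

/-- The homogeneity `[Δ, Γ] = Γ` in canonical coordinates. -/
lemma lieBracket_localField {e : OpenPartialHomeomorph M (Coord n)} (he : e ∈ charts n M)
    {Γ : TMField n M} (hΓ : IsSpray Γ) {p : Coord n × Coord n} (hp : p ∈ slitDomain e) :
    VectorField.lieBracket ℝ (fun q : Coord n × Coord n => ((0 : Coord n), q.2)) (localField e Γ) p
      = localField e Γ p := by
  have h1 := hΓ.smooth.contMDiffAt (isOpen_slit.mem_nhds (param_mem_slit he hp))
  have hm : minSmoothness ℝ 2 ≤ (∞ : WithTop ℕ∞) := by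
    rw [minSmoothness_of_isRCLikeNormedField]
    exact WithTop.coe_le_coe.2 le_top
  have : IsManifold (𝓡 n).tangent (minSmoothness ℝ 2) (TangentBundle (𝓡 n) M) :=
    IsManifold.of_le (n := ∞) hm
  have h := VectorField.mpullback_mlieBracket
    ((contMDiffAt_liouville he hp.1).mdifferentiableAt (by simp))
    (h1.mdifferentiableAt (by simp)) (contMDiffAt_param he hp.1) hm
  have h2 : VectorField.mpullback 𝓘(ℝ, Coord n × Coord n) (𝓡 n).tangent (param e)
      (VectorField.mlieBracket (𝓡 n).tangent (liouville n M) Γ) p = localField e Γ p := by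
    simp only [localField, VectorField.mpullback_apply]
    rw [hΓ.bracket _ (param_mem_slit he hp)]
  rw [h2, ← VectorField.mlieBracketWithin_univ,
    VectorField.mlieBracketWithin_eq_lieBracketWithin] at h
  have h3 : localField e Γ p = VectorField.lieBracketWithin ℝ (localField e (liouville n M))
    (localField e Γ) univ p := h
  rw [VectorField.lieBracketWithin_univ] at h3
  refine Eq.trans ?_ h3.symm
  refine Filter.EventuallyEq.lieBracket_vectorField_eq ?_ (EventuallyEq.refl _ _)
  filter_upwards [(e.open_target.preimage continuous_fst).mem_nhds hp.1] with q hq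
  exact (localField_liouville he hq).symm

lemma localField_of_projEquiv {e : OpenPartialHomeomorph M (Coord n)} (he : e ∈ charts n M)
    {Γ Γ' : TMField n M} {P : TangentBundle (𝓡 n) M → ℝ}
    (h : ∀ v ∈ slit n M, Γ' v = Γ v - (2 * P v) • liouville n M v)
    {p : Coord n × Coord n} (hp : p ∈ slitDomain e) :
    localField e Γ' p = localField e Γ p - (2 * localFun e P p) • ((0 : Coord n), p.2) := by
  refine localField_eq_of_mfderiv_eq he hp.1 ?_
  rw [h _ (param_mem_slit he hp), ← mfderiv_param_localField he Γ hp.1,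
    ← mfderiv_param_localField he (liouville n M) hp.1, localField_liouville he hp.1]
  simp only [localFun]
  erw [map_sub, map_smul]

lemma reflection_param (e : OpenPartialHomeomorph M (Coord n)) (p : Coord n × Coord n) :
    reflection (param e p) = param e (p.1, -p.2) :=
  Bundle.TotalSpace.ext rfl (heq_of_eq (map_neg _ _).symm)

/-- The fibre reflection `(x, y) ↦ (x, -y)` of the coordinate space. -/
def fibreFlip (n : ℕ) : (Coord n × Coord n) ≃L[ℝ] (Coord n × Coord n) :=
  (ContinuousLinearEquiv.refl ℝ (Coord n)).prodCongr (ContinuousLinearEquiv.neg ℝ)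

lemma fibreFlip_apply (p : Coord n × Coord n) : fibreFlip n p = (p.1, -p.2) := rfl

lemma localField_reverse {e : OpenPartialHomeomorph M (Coord n)} (he : e ∈ charts n M)
    {Γ : TMField n M} {p : Coord n × Coord n} (hp : p.1 ∈ e.target) :
    localField e (reverse Γ) p =
      (-(localField e Γ (fibreFlip n p)).1, (localField e Γ (fibreFlip n p)).2) := by
  have hv : (param e p).proj ∈ e.source := e.map_target hp
  have hp' : (fibreFlip n p).1 ∈ e.target := hp
  have d1 := ((contMDiffAt_param he hp').mdifferentiableAt (by simp)).hasMFDerivAt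
  have d2 := ((contMDiffAt_coparam he hv).mdifferentiableAt (by simp)).hasMFDerivAt
  have d3 : HasMFDerivAt 𝓘(ℝ, Coord n × Coord n) 𝓘(ℝ, Coord n × Coord n) (fibreFlip n) p
    (fibreFlip n : (Coord n × Coord n) →L[ℝ] (Coord n × Coord n)) := (fibreFlip n).hasFDerivAt.hasMFDerivAt
  rw [← coparam_param he hp] at d3 d1
  have d4 := (d1.comp _ d3).comp _ d2
  rw [coparam_param he hp] at d4
  have heq : reflection =ᶠ[𝓝 (param e p)] (param e ∘ fibreFlip n) ∘ coparam e := by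
    filter_upwards [(isOpen_proj_preimage e).mem_nhds hv] with v hv
    simp only [Function.comp, fibreFlip_apply]
    rw [← reflection_param, param_coparam he hv]
  have d5 := d4.congr_of_eventuallyEq heq
  have hinv : (mfderiv (𝓡 n).tangent (𝓡 n).tangent reflection (param e p)).IsInvertible := by
    rw [d5.mfderiv]
    refine ContinuousLinearMap.IsInvertible.comp ?_ (isInvertible_mfderiv_coparam he hp)
    refine ContinuousLinearMap.IsInvertible.comp (isInvertible_mfderiv_param he hp') ?_
    exact ⟨fibreFlip n, rfl⟩
  set a := localField e Γ (fibreFlip n p) with ha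
  refine localField_eq_of_mfderiv_eq he hp ?_
  have h1 : mfderiv (𝓡 n).tangent (𝓡 n).tangent reflection (param e p)
      (mfderiv 𝓘(ℝ, Coord n × Coord n) (𝓡 n).tangent (param e) p (a.1, -a.2))
      = Γ (param e (fibreFlip n p)) := by
    rw [d5.mfderiv]
    refine Eq.trans ?_ (mfderiv_param_localField he Γ hp')
    have h2 := congrArg (fun L => L (a.1, -a.2)) (mfderiv_coparam_comp_param he hp)
    refine (congrArg (fun u => mfderiv 𝓘(ℝ, Coord n × Coord n) (𝓡 n).tangent (param e) (fibreFlip n p)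
      (fibreFlip n u)) h2).trans ?_
    refine congrArg (mfderiv 𝓘(ℝ, Coord n × Coord n) (𝓡 n).tangent (param e) (fibreFlip n p)) ?_
    exact Prod.ext rfl (neg_neg a.2)
  have h3 := hinv.inverse_apply_self
    (mfderiv 𝓘(ℝ, Coord n × Coord n) (𝓡 n).tangent (param e) p (a.1, -a.2))
  rw [h1] at h3
  have h4 : reverse Γ (param e p) =
      -mfderiv 𝓘(ℝ, Coord n × Coord n) (𝓡 n).tangent (param e) p (a.1, -a.2) := by
    rw [← h3]
    exact congrArg (fun u : Coord n × Coord n =>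
      -(mfderiv (𝓡 n).tangent (𝓡 n).tangent reflection (param e p)).inverse u)
      (congrArg (fun v => (Γ v : Coord n × Coord n)) (reflection_param e p))
  rw [h4]
  refine Eq.trans ?_ (map_neg _ _)
  refine congrArg (mfderiv 𝓘(ℝ, Coord n × Coord n) (𝓡 n).tangent (param e) p) ?_
  exact Prod.ext rfl (neg_neg a.2).symm

end Sprays

/-! ### Partial derivatives in canonical coordinates -/

section Calculus

variable {n : ℕ} {S : Set (Coord n × Coord n)} {f g : Coord n × Coord n → ℝ}
  {p : Coord n × Coord n}

lemma stdVec_apply (i j : Fin n) : (stdVec i : Coord n) j = if j = i then 1 else 0 := by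
  simp [stdVec]

lemma sum_smul_stdVec (v : Coord n) : ∑ i, v i • stdVec i = v := by
  ext j
  simp [stdVec_apply]

lemma fderiv_apply_eq_sum (f : Coord n × Coord n → ℝ) (p u : Coord n × Coord n) :
    fderiv ℝ f p u = ∑ i, u.1 i * dx i f p + ∑ i, u.2 i * dy i f p := by
  have h : u = ∑ i, u.1 i • ((stdVec i, 0) : Coord n × Coord n)
      + ∑ i, u.2 i • ((0, stdVec i) : Coord n × Coord n) := by
    refine Prod.ext ?_ ?_
    · simp [Prod.fst_sum, sum_smul_stdVec]
    · simp [Prod.snd_sum, sum_smul_stdVec]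
  conv_lhs => rw [h]
  rw [map_add, map_sum, map_sum]
  simp only [map_smul, smul_eq_mul, dx, dy]

lemma fderiv_vert_eq_sum (f : Coord n × Coord n → ℝ) (p : Coord n × Coord n) (v : Coord n) :
    fderiv ℝ f p (0, v) = ∑ i, v i * dy i f p := by
  simp [fderiv_apply_eq_sum]

lemma sum_smul_stdVec_apply (g : Fin n → ℝ) (j : Fin n) :
    (∑ i, g i • stdVec i : Coord n) j = g j := by
  simp [stdVec_apply]

lemma smooth_differentiableAt {G : Type*} [NormedAddCommGroup G] [NormedSpace ℝ G]
    {f : Coord n × Coord n → G} (hS : IsOpen S) (hf : ContDiffOn ℝ ∞ f S) (hp : p ∈ S) :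
    DifferentiableAt ℝ f p :=
  (hf.contDiffAt (hS.mem_nhds hp)).differentiableAt (by simp)

lemma contDiffOn_fderiv_apply (hS : IsOpen S) (hf : ContDiffOn ℝ ∞ f S)
    {X : Coord n × Coord n → Coord n × Coord n} (hX : ContDiffOn ℝ ∞ X S) :
    ContDiffOn ℝ ∞ (fun q => fderiv ℝ f q (X q)) S :=
  (hf.fderiv_of_isOpen hS le_rfl).clm_apply hX

lemma contDiffOn_dx (hS : IsOpen S) (hf : ContDiffOn ℝ ∞ f S) (i : Fin n) :
    ContDiffOn ℝ ∞ (dx i f) S :=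
  contDiffOn_fderiv_apply hS hf contDiffOn_const

lemma contDiffOn_dy (hS : IsOpen S) (hf : ContDiffOn ℝ ∞ f S) (i : Fin n) :
    ContDiffOn ℝ ∞ (dy i f) S :=
  contDiffOn_fderiv_apply hS hf contDiffOn_const

lemma fderiv_congr_of_eqOn {G : Type*} [NormedAddCommGroup G] [NormedSpace ℝ G]
    {f g : Coord n × Coord n → G} (hS : IsOpen S) (h : EqOn f g S) (hp : p ∈ S) :
    fderiv ℝ f p = fderiv ℝ g p :=
  (h.eventuallyEq_of_mem (hS.mem_nhds hp)).fderiv_eq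

lemma dy_congr (hS : IsOpen S) (h : EqOn f g S) (hp : p ∈ S) (i : Fin n) :
    dy i f p = dy i g p := by
  simp only [dy, fderiv_congr_of_eqOn hS h hp]

/-- Differentiating `X f` in the direction `u`: symmetry of second derivatives moves `u` inside. -/
lemma fderiv_fderiv_apply (hS : IsOpen S) (hf : ContDiffOn ℝ ∞ f S)
    {X : Coord n × Coord n → Coord n × Coord n} (hX : ContDiffOn ℝ ∞ X S) (hp : p ∈ S)
    (u : Coord n × Coord n) :
    fderiv ℝ (fun q => fderiv ℝ f q (X q)) p u
      = fderiv ℝ (fun q => fderiv ℝ f q u) p (X p) + fderiv ℝ f p (fderiv ℝ X p u) := by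
  have h1 : DifferentiableAt ℝ (fderiv ℝ f) p :=
    smooth_differentiableAt hS (hf.fderiv_of_isOpen hS le_rfl) hp
  have h2 := smooth_differentiableAt hS hX hp
  have hsymm : IsSymmSndFDerivAt ℝ f p :=
    (hf.contDiffAt (hS.mem_nhds hp)).isSymmSndFDerivAt (by
      rw [minSmoothness_of_isRCLikeNormedField]
      exact WithTop.coe_le_coe.2 le_top)
  rw [fderiv_clm_apply h1 h2, fderiv_clm_apply h1 (differentiableAt_const u)]
  simp only [add_apply, ContinuousLinearMap.comp_apply,
    ContinuousLinearMap.flip_apply, fderiv_fun_const, Pi.zero_apply, zero_apply,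
    map_zero, zero_add]
  rw [hsymm.eq, add_comm]

lemma fderiv_fderiv_const_comm (hS : IsOpen S) (hf : ContDiffOn ℝ ∞ f S) (hp : p ∈ S)
    (u v : Coord n × Coord n) :
    fderiv ℝ (fun q => fderiv ℝ f q u) p v = fderiv ℝ (fun q => fderiv ℝ f q v) p u := by
  have := fderiv_fderiv_apply hS hf (X := fun _ => u) contDiffOn_const hp v
  simpa using this

lemma dy_dy_comm (hS : IsOpen S) (hf : ContDiffOn ℝ ∞ f S) (hp : p ∈ S) (i j : Fin n) :
    dy i (dy j f) p = dy j (dy i f) p := fderiv_fderiv_const_comm hS hf hp _ _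

lemma dy_dx_comm (hS : IsOpen S) (hf : ContDiffOn ℝ ∞ f S) (hp : p ∈ S) (i j : Fin n) :
    dy i (dx j f) p = dx j (dy i f) p := fderiv_fderiv_const_comm hS hf hp _ _

lemma dx_dx_comm (hS : IsOpen S) (hf : ContDiffOn ℝ ∞ f S) (hp : p ∈ S) (i j : Fin n) :
    dx i (dx j f) p = dx j (dx i f) p := fderiv_fderiv_const_comm hS hf hp _ _

lemma fderiv_lieBracket (hS : IsOpen S) (hf : ContDiffOn ℝ ∞ f S)
    {X Y : Coord n × Coord n → Coord n × Coord n} (hX : ContDiffOn ℝ ∞ X S)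
    (hY : ContDiffOn ℝ ∞ Y S) (hp : p ∈ S) :
    fderiv ℝ f p (VectorField.lieBracket ℝ X Y p)
      = fderiv ℝ (fun q => fderiv ℝ f q (Y q)) p (X p)
        - fderiv ℝ (fun q => fderiv ℝ f q (X q)) p (Y p) := by
  rw [fderiv_fderiv_apply hS hf hY hp, fderiv_fderiv_apply hS hf hX hp, VectorField.lieBracket,
    map_sub, fderiv_fderiv_const_comm hS hf hp (X p) (Y p)]
  ring

lemma fderiv_sum_mul {ι : Type*} (s : Finset ι) {a b : ι → Coord n × Coord n → ℝ}
    (ha : ∀ i, DifferentiableAt ℝ (a i) p) (hb : ∀ i, DifferentiableAt ℝ (b i) p)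
    (u : Coord n × Coord n) :
    fderiv ℝ (fun q => ∑ i ∈ s, a i q * b i q) p u
      = ∑ i ∈ s, (fderiv ℝ (a i) p u * b i p + a i p * fderiv ℝ (b i) p u) := by
  rw [fderiv_fun_sum fun i _ => (ha i).fun_mul (hb i)]
  simp only [sum_apply]
  refine Finset.sum_congr rfl fun i _ => ?_
  rw [fderiv_fun_mul (ha i) (hb i)]
  simp only [add_apply, smul_apply, smul_eq_mul]
  ring

/-- The `i`-th fibre coordinate. -/
def yCoord (i : Fin n) : (Coord n × Coord n) →L[ℝ] ℝ :=
  (EuclideanSpace.proj i).comp (ContinuousLinearMap.snd ℝ (Coord n) (Coord n))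

lemma fderiv_yCoord (i : Fin n) (p u : Coord n × Coord n) :
    fderiv ℝ (fun q : Coord n × Coord n => q.2 i) p u = u.2 i := by
  change fderiv ℝ (yCoord i) p u = _
  rw [ContinuousLinearMap.fderiv]
  rfl

lemma differentiableAt_yCoord (i : Fin n) (p : Coord n × Coord n) :
    DifferentiableAt ℝ (fun q : Coord n × Coord n => q.2 i) p :=
  (yCoord i).differentiableAt

lemma fderiv_comp_flip (f : Coord n × Coord n → ℝ) (p u : Coord n × Coord n) :
    fderiv ℝ (fun q => f (fibreFlip n q)) p u = fderiv ℝ f (fibreFlip n p) (fibreFlip n u) := by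
  have h := (fibreFlip n).comp_right_fderiv (f := f) (x := p)
  exact congrArg (fun L => L u) h

lemma dx_comp_flip (f : Coord n × Coord n → ℝ) (p : Coord n × Coord n) (i : Fin n) :
    dx i (fun q => f (fibreFlip n q)) p = dx i f (fibreFlip n p) := by
  simp only [dx, fderiv_comp_flip]
  congr 1
  simp [fibreFlip_apply]

lemma dy_comp_flip (f : Coord n × Coord n → ℝ) (p : Coord n × Coord n) (i : Fin n) :
    dy i (fun q => f (fibreFlip n q)) p = -dy i f (fibreFlip n p) := by
  simp only [dy, fderiv_comp_flip, ← map_neg]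
  congr 1
  simp [fibreFlip_apply]

end Calculus

/-! ### The calculus of a spray in coordinates -/

/-- `X = y ∂/∂x - 2Γ ∂/∂y` is a smooth second-order field on the open set `S` of the coordinate
space. -/
structure IsSecondOrder {n : ℕ} (X : Coord n × Coord n → Coord n × Coord n)
    (S : Set (Coord n × Coord n)) : Prop where
  isOpen : IsOpen S
  smooth : ContDiffOn ℝ ∞ X S
  fst : ∀ p ∈ S, (X p).1 = p.2

section LocalSpray

variable {n : ℕ} {S : Set (Coord n × Coord n)} {f : Coord n × Coord n → ℝ}
  {X : Coord n × Coord n → Coord n × Coord n} {p : Coord n × Coord n}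

/-- `Γⁱ` for a second-order field in coordinates. For `X = localField e Γ` this and the next three
notions are `coeff`, `conn`, `horiz` and `riemann` by definition. -/
def lcoeff (X : Coord n × Coord n → Coord n × Coord n) (i : Fin n) : Coord n × Coord n → ℝ :=
  fun p => -(1 / 2) * (X p).2 i

/-- `Γⁱⱼ` for a second-order field in coordinates. -/
def lconn (X : Coord n × Coord n → Coord n × Coord n) (i j : Fin n) : Coord n × Coord n → ℝ :=
  dy j (lcoeff X i)

/-- `Hᵢ` for a second-order field in coordinates. -/
def lhoriz (X : Coord n × Coord n → Coord n × Coord n) (i : Fin n) :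
    Coord n × Coord n → Coord n × Coord n :=
  fun p => (stdVec i, -∑ j, lconn X j i p • stdVec j)

/-- `Rʲᵢ` for a second-order field in coordinates. -/
def lriemann (X : Coord n × Coord n → Coord n × Coord n) (j i : Fin n) :
    Coord n × Coord n → ℝ :=
  fun p => (VectorField.lieBracket ℝ X (lhoriz X i) p
    - ∑ k, lconn X k i p • lhoriz X k p).2 j

/-- `(∇h)ᵢⱼ` for a second-order field and a tensor in coordinates. -/
def lnabla (X : Coord n × Coord n → Coord n × Coord n) (h : Fin n → Fin n → Coord n × Coord n → ℝ)
    (i j : Fin n) : Coord n × Coord n → ℝ :=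
  fun p => fderiv ℝ (h i j) p (X p)
    - ∑ k, lconn X k i p * h k j p - ∑ k, lconn X k j p * h i k p

/-- The Euler-Lagrange expression `X(∂f/∂yⁱ) - ∂f/∂xⁱ`. -/
def lEuler (X : Coord n × Coord n → Coord n × Coord n) (f : Coord n × Coord n → ℝ) (i : Fin n) :
    Coord n × Coord n → ℝ :=
  fun p => fderiv ℝ (dy i f) p (X p) - dx i f p

lemma contDiffOn_lcoeff (hX : IsSecondOrder X S) (i : Fin n) : ContDiffOn ℝ ∞ (lcoeff X i) S :=
  contDiffOn_const.mul ((yCoord i).contDiff.comp_contDiffOn hX.smooth)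

lemma contDiffOn_lconn (hX : IsSecondOrder X S) (i j : Fin n) : ContDiffOn ℝ ∞ (lconn X i j) S :=
  contDiffOn_dy hX.isOpen (contDiffOn_lcoeff hX i) j

lemma contDiffOn_lhoriz (hX : IsSecondOrder X S) (i : Fin n) : ContDiffOn ℝ ∞ (lhoriz X i) S :=
  contDiffOn_const.prodMk
    (ContDiffOn.neg (ContDiffOn.sum fun j _ => (contDiffOn_lconn hX j i).smul contDiffOn_const))

lemma contDiffOn_lEuler (hX : IsSecondOrder X S) (hf : ContDiffOn ℝ ∞ f S) (i : Fin n) :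
    ContDiffOn ℝ ∞ (lEuler X f i) S :=
  (contDiffOn_fderiv_apply hX.isOpen (contDiffOn_dy hX.isOpen hf i) hX.smooth).sub
    (contDiffOn_dx hX.isOpen hf i)

lemma fderiv_field_vert (hX : IsSecondOrder X S) (hp : p ∈ S) (v : Coord n) :
    fderiv ℝ X p (0, v) = (v, -(2 : ℝ) • ∑ k, (∑ j, v j * lconn X k j p) • stdVec k) := by
  have hd := smooth_differentiableAt hX.isOpen hX.smooth hp
  refine Prod.ext ?_ ?_
  · have h1 : fderiv ℝ (fun q => (X q).1) p = fderiv ℝ (fun q : Coord n × Coord n => q.2) p :=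
      fderiv_congr_of_eqOn hX.isOpen (fun q hq => hX.fst q hq) hp
    rw [hd.hasFDerivAt.fst.fderiv, fderiv_snd] at h1
    exact congrArg (fun L => L (0, v)) h1
  · ext k
    have h1 : fderiv ℝ (lcoeff X k) p (0, v) = -(1 / 2) * (fderiv ℝ X p (0, v)).2 k := by
      have h2 : HasFDerivAt (fun q => yCoord k (X q)) ((yCoord k).comp (fderiv ℝ X p)) p :=
        (yCoord k).hasFDerivAt.comp p hd.hasFDerivAt
      have h3 := (h2.const_mul (-(1 / 2) : ℝ)).fderiv
      exact congrArg (fun L => L (0, v)) h3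
    rw [fderiv_vert_eq_sum] at h1
    simp only [lconn, PiLp.smul_apply, smul_eq_mul, sum_smul_stdVec_apply]
    rw [h1]
    ring

/-- Differentiating `X f` along the fibre. -/
lemma dy_field_apply (hX : IsSecondOrder X S) (hf : ContDiffOn ℝ ∞ f S) (hp : p ∈ S) (j : Fin n) :
    dy j (fun q => fderiv ℝ f q (X q)) p
      = fderiv ℝ (dy j f) p (X p) + dx j f p - 2 * ∑ k, lconn X k j p * dy k f p := by
  rw [dy, fderiv_fderiv_apply hX.isOpen hf hX.smooth hp, fderiv_field_vert hX hp,
    fderiv_apply_eq_sum f p]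
  have h1 : ∀ g : Fin n → ℝ, ∑ i, (stdVec j : Coord n) i * g i = g j := fun g => by
    simp [stdVec_apply]
  have h2 : fderiv ℝ (fun q => fderiv ℝ f q (0, stdVec j)) p (X p) = fderiv ℝ (dy j f) p (X p) :=
    rfl
  simp only [h1, h2, PiLp.smul_apply, smul_eq_mul, sum_smul_stdVec_apply]
  simp only [mul_assoc, ← Finset.mul_sum]
  ring

/-- The fibre derivative of the Euler-Lagrange expression: its symmetric part is `∇` of the
fibre Hessian. -/
lemma dy_lEuler (hX : IsSecondOrder X S) (hf : ContDiffOn ℝ ∞ f S) (hp : p ∈ S) (i j : Fin n) :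
    dy j (lEuler X f i) p = fderiv ℝ (dy j (dy i f)) p (X p) + dx j (dy i f) p
      - 2 * ∑ k, lconn X k j p * dy k (dy i f) p - dx i (dy j f) p := by
  have hi := contDiffOn_dy hX.isOpen hf i
  have h1 := smooth_differentiableAt hX.isOpen (contDiffOn_fderiv_apply hX.isOpen hi hX.smooth) hp
  have h2 := smooth_differentiableAt hX.isOpen (contDiffOn_dx hX.isOpen hf i) hp
  rw [← dy_field_apply hX hi hp j, ← dy_dx_comm hX.isOpen hf hp j i]
  have h3 : fderiv ℝ (lEuler X f i) p = _ := fderiv_fun_sub h1 h2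
  exact congrArg (fun L => L (0, stdVec j)) h3

lemma fderiv_hessian_symm (hS : IsOpen S) (hf : ContDiffOn ℝ ∞ f S) (hp : p ∈ S) (i j : Fin n) :
    fderiv ℝ (dy j (dy i f)) p = fderiv ℝ (dy i (dy j f)) p :=
  fderiv_congr_of_eqOn hS (fun _ hq => dy_dy_comm hS hf hq j i) hp

lemma dy_lEuler_add (hX : IsSecondOrder X S) (hf : ContDiffOn ℝ ∞ f S) (hp : p ∈ S)
    (i j : Fin n) :
    dy j (lEuler X f i) p + dy i (lEuler X f j) p
      = 2 * lnabla X (fun i j => dy i (dy j f)) i j p := by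
  rw [dy_lEuler hX hf hp, dy_lEuler hX hf hp, fderiv_hessian_symm hX.isOpen hf hp i j]
  simp only [lnabla, dy_dy_comm hX.isOpen hf hp i]
  ring

lemma fderiv_lhoriz (f : Coord n × Coord n → ℝ) (p : Coord n × Coord n) (i : Fin n) :
    fderiv ℝ f p (lhoriz X i p) = dx i f p - ∑ k, lconn X k i p * dy k f p := by
  rw [fderiv_apply_eq_sum]
  simp [lhoriz, stdVec_apply, sub_eq_add_neg, Finset.sum_neg_distrib]

/-- The bracket of the spray with a horizontal field, split into horizontal and vertical parts. -/
lemma lieBracket_lhoriz (hX : IsSecondOrder X S) (hp : p ∈ S) (i : Fin n) :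
    VectorField.lieBracket ℝ X (lhoriz X i) p
      = ∑ k, lconn X k i p • lhoriz X k p + (0, ∑ k, lriemann X k i p • stdVec k) := by
  refine Prod.ext ?_ ?_
  · have hd := smooth_differentiableAt hX.isOpen hX.smooth hp
    have h1 : fderiv ℝ (fun q => (X q).1) p = fderiv ℝ (fun q : Coord n × Coord n => q.2) p :=
      fderiv_congr_of_eqOn hX.isOpen (fun q hq => hX.fst q hq) hp
    rw [hd.hasFDerivAt.fst.fderiv, fderiv_snd] at h1
    have h2 : ∀ u, (fderiv ℝ X p u).1 = u.2 := fun u => congrArg (fun L => L u) h1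
    have hd' := smooth_differentiableAt hX.isOpen (contDiffOn_lhoriz hX i) hp
    have h3 : fderiv ℝ (fun q => (lhoriz X i q).1) p = 0 := by
      simp only [lhoriz, fderiv_fun_const, Pi.zero_apply]
    rw [hd'.hasFDerivAt.fst.fderiv] at h3
    have h4 : ∀ u, (fderiv ℝ (lhoriz X i) p u).1 = 0 := fun u => congrArg (fun L => L u) h3
    simp [VectorField.lieBracket, h2, h4, Prod.fst_sum, lhoriz]
  · simp only [Prod.snd_add, lriemann, Prod.snd_sub, sum_smul_stdVec]
    abel

/-- If `X` satisfies the Euler-Lagrange equations of `f`, the Jacobi endomorphism of `X` is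
self-adjoint for the fibre Hessian of `f`. -/
lemma hessian_riemann_symm (hX : IsSecondOrder X S) (hf : ContDiffOn ℝ ∞ f S)
    (hE : ∀ q ∈ S, ∀ i, lEuler X f i q = 0) (hp : p ∈ S) (i j : Fin n) :
    ∑ k, dy i (dy k f) p * lriemann X k j p = ∑ k, dy j (dy k f) p * lriemann X k i p := by
  have hS := hX.isOpen
  have hdy : ∀ q ∈ S, ∀ i j, dy j (lEuler X f i) q = 0 := fun q hq i j => by
    rw [dy_congr (g := fun _ => 0) hS (fun q hq => hE q hq i) hq]
    simp [dy]
  -- The antisymmetric part of the differentiated equations: `Hⱼ(∂ᵢf) = Hᵢ(∂ⱼf)`.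
  have hH : ∀ i j, EqOn (fun q => fderiv ℝ (dy i f) q (lhoriz X j q))
      (fun q => fderiv ℝ (dy j f) q (lhoriz X i q)) S := by
    intro i j q hq
    have h1 := hdy q hq i j
    have h2 := hdy q hq j i
    rw [dy_lEuler hX hf hq] at h1 h2
    rw [fderiv_hessian_symm hS hf hq i j] at h1
    simp only [fderiv_lhoriz]
    linarith
  have key : ∀ i j, fderiv ℝ (fun q => fderiv ℝ (dy i f) q (lhoriz X j q)) p (X p)
      = dx j (dx i f) p - ∑ k, ∑ l, lconn X k j p * (lconn X l i p * dy l (dy k f) p)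
        + ∑ k, dy i (dy k f) p * lriemann X k j p := by
    intro i j
    have h1 := fderiv_lieBracket hS (contDiffOn_dy hS hf i) hX.smooth (contDiffOn_lhoriz hX j) hp
    have h2 : fderiv ℝ (fun q => fderiv ℝ (dy i f) q (X q)) p = fderiv ℝ (dx i f) p :=
      fderiv_congr_of_eqOn hS (fun q hq => sub_eq_zero.1 (hE q hq i)) hp
    rw [h2, fderiv_lhoriz, lieBracket_lhoriz hX hp, map_add, map_sum, fderiv_vert_eq_sum] at h1
    have h3 : ∀ k, fderiv ℝ (dy i f) p (lconn X k j p • lhoriz X k p)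
        = lconn X k j p * dy k (dx i f) p
          - ∑ l, lconn X k j p * (lconn X l i p * dy l (dy k f) p) := fun k => by
      have h4 : fderiv ℝ (dy i f) p (lhoriz X k p) = fderiv ℝ (dy k f) p (lhoriz X i p) :=
        hH i k hp
      rw [map_smul, smul_eq_mul, h4, fderiv_lhoriz, mul_sub, Finset.mul_sum,
        dy_dx_comm hS hf hp]
    simp only [h3, Finset.sum_sub_distrib, sum_smul_stdVec_apply] at h1
    simp only [dy_dy_comm hS hf hp i]
    have h4 : ∑ k, dy k (dy i f) p * lriemann X k j p = ∑ k, lriemann X k j p * dy k (dy i f) p :=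
      Finset.sum_congr rfl fun k _ => mul_comm _ _
    linarith
  have h5 := key i j
  rw [fderiv_congr_of_eqOn hS (hH i j) hp, key j i, dx_dx_comm hS hf hp i j] at h5
  have h6 : ∑ k, ∑ l, lconn X k i p * (lconn X l j p * dy l (dy k f) p)
      = ∑ k, ∑ l, lconn X k j p * (lconn X l i p * dy l (dy k f) p) := by
    rw [Finset.sum_comm]
    refine Finset.sum_congr rfl fun k _ => Finset.sum_congr rfl fun l _ => ?_
    rw [dy_dy_comm hS hf hp k l]
    ring
  linarith

end LocalSpray

/-! ### Even potentials of a reversible spray -/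

section Reversible

variable {n : ℕ} {S : Set (Coord n × Coord n)} {f : Coord n × Coord n → ℝ}
  {X : Coord n × Coord n → Coord n × Coord n} {p : Coord n × Coord n}

lemma dy_neg (f : Coord n × Coord n → ℝ) (p : Coord n × Coord n) (i : Fin n) :
    dy i (fun q => -f q) p = -dy i f p := by
  simp only [dy]
  rw [fderiv_fun_neg]
  rfl

/-- A tensor in coordinates satisfying the algebraic and fibrewise conditions on a multiplier. -/
structure IsFibreHessian (h : Fin n → Fin n → Coord n × Coord n → ℝ)
    (S : Set (Coord n × Coord n)) : Prop where
  smooth : ∀ i j, ContDiffOn ℝ ∞ (h i j) S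
  symm : ∀ p ∈ S, ∀ i j, h j i p = h i j p
  radial : ∀ p ∈ S, ∀ i, ∑ j, h i j p * p.2 j = 0
  closed : ∀ p ∈ S, ∀ i j k, dy k (h i j) p = dy j (h i k) p

lemma IsFibreHessian.euler {h : Fin n → Fin n → Coord n × Coord n → ℝ} (hS : IsOpen S)
    (hh : IsFibreHessian h S) (hp : p ∈ S) (i j : Fin n) :
    ∑ k, p.2 k * dy k (h i j) p = -h i j p := by
  have h1 : fderiv ℝ (fun q : Coord n × Coord n => ∑ k, h i k q * q.2 k) p (0, stdVec j) = 0 := by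
    rw [fderiv_congr_of_eqOn (g := fun _ => 0) hS (fun q hq => hh.radial q hq i) hp]
    simp
  rw [fderiv_sum_mul Finset.univ (fun k => smooth_differentiableAt hS (hh.smooth i k) hp)
    (fun k => differentiableAt_yCoord k p), Finset.sum_add_distrib] at h1
  simp only [fderiv_yCoord, stdVec_apply, mul_ite, mul_one, mul_zero, Finset.sum_ite_eq',
    Finset.mem_univ, if_true] at h1
  rw [← eq_neg_iff_add_eq_zero] at h1
  rw [← h1]
  refine Finset.sum_congr rfl fun k _ => ?_
  rw [hh.closed p hp i j k, mul_comm]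
  rfl

/-- If the spray differs from its reverse by a multiple of the Liouville field, the reflection of
a parallel fibre Hessian is parallel. -/
lemma lnabla_comp_flip (hX : IsSecondOrder X S) (hflip : ∀ q ∈ S, fibreFlip n q ∈ S)
    {c : Coord n × Coord n → ℝ} (hc : ContDiffOn ℝ ∞ c S)
    (hXc : ∀ q ∈ S, (X (fibreFlip n q)).2 = (X q).2 + c q • q.2)
    {h : Fin n → Fin n → Coord n × Coord n → ℝ} (hh : IsFibreHessian h S)
    (hpar : ∀ q ∈ S, ∀ i j, lnabla X h i j q = 0) (hp : p ∈ S) (i j : Fin n) :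
    lnabla X (fun i j q => h i j (fibreFlip n q)) i j p = 0 := by
  have hS := hX.isOpen
  have hp' := hflip p hp
  have hconn : ∀ k i, lconn X k i (fibreFlip n p)
      = -lconn X k i p + 1 / 2 * (dy i c p * p.2 k + c p * (if k = i then 1 else 0)) := by
    intro k i
    have h1 : dy i (fun q => lcoeff X k (fibreFlip n q)) p
        = dy i (fun q => lcoeff X k q - 1 / 2 * (c q * q.2 k)) p := by
      refine dy_congr hS (fun q hq => ?_) hp i
      simp only [lcoeff, hXc q hq, PiLp.add_apply, PiLp.smul_apply, smul_eq_mul]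
      ring
    have hd1 := smooth_differentiableAt hS (contDiffOn_lcoeff hX k) hp
    have hd2 := smooth_differentiableAt hS hc hp
    have hd3 := differentiableAt_yCoord k p
    rw [dy_comp_flip] at h1
    simp only [dy] at h1
    rw [fderiv_fun_sub hd1 ((hd2.fun_mul hd3).const_mul _),
      fderiv_const_mul (hd2.fun_mul hd3), fderiv_fun_mul hd2 hd3] at h1
    simp only [sub_apply, smul_apply, add_apply, smul_eq_mul, fderiv_yCoord, stdVec_apply] at h1
    simp only [lconn]
    simp only [dy] at h1 ⊢
    linarith
  have h0 := hpar _ hp' i j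
  have hsum : ∀ i j, ∑ k, lconn X k i (fibreFlip n p) * h k j (fibreFlip n p)
      = -∑ k, lconn X k i p * h k j (fibreFlip n p) + 1 / 2 * (c p * h i j (fibreFlip n p)) := by
    intro i j
    have hr := hh.radial _ hp' j
    simp only [hconn, add_mul, Finset.sum_add_distrib, neg_mul, Finset.sum_neg_distrib]
    congr 1
    have h2 : ∑ k, p.2 k * h k j (fibreFlip n p) = 0 := by
      have h3 : ∑ k, h j k (fibreFlip n p) * (fibreFlip n p).2 k = -∑ k, p.2 k * h k j (fibreFlip n p) := by
        rw [← Finset.sum_neg_distrib]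
        refine Finset.sum_congr rfl fun k _ => ?_
        rw [hh.symm _ hp' k j]
        simp [fibreFlip_apply, mul_comm]
      rw [hr] at h3
      linarith
    have h4 : ∀ k, 1 / 2 * (dy i c p * p.2 k + c p * (if k = i then 1 else 0)) * h k j (fibreFlip n p)
        = 1 / 2 * dy i c p * (p.2 k * h k j (fibreFlip n p))
          + (if k = i then 1 / 2 * (c p * h k j (fibreFlip n p)) else 0) := fun k => by
      split_ifs <;> ring
    simp only [h4, Finset.sum_add_distrib, ← Finset.mul_sum, h2, Finset.sum_ite_eq',
      Finset.mem_univ, if_true]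
    ring
  have hsum' : ∀ i j, ∑ k, lconn X k j (fibreFlip n p) * h i k (fibreFlip n p)
      = -∑ k, lconn X k j p * h i k (fibreFlip n p) + 1 / 2 * (c p * h i j (fibreFlip n p)) := by
    intro i j
    simpa only [hh.symm _ hp'] using hsum j i
  have hfld : fderiv ℝ (h i j) (fibreFlip n p) (X (fibreFlip n p))
      = -fderiv ℝ (fun q => h i j (fibreFlip n q)) p (X p) + c p * h i j (fibreFlip n p) := by
    have h1 : X (fibreFlip n p) = fibreFlip n (-X p - c p • ((0 : Coord n), p.2)) := by
      refine Prod.ext ?_ ?_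
      · rw [hX.fst _ hp']
        simp [fibreFlip_apply, hX.fst _ hp]
      · rw [hXc p hp]
        simp [fibreFlip_apply, add_comm]
    have h2 := hh.euler hS hp' i j
    have h3 : fderiv ℝ (fun q => h i j (fibreFlip n q)) p ((0 : Coord n), p.2) = -h i j (fibreFlip n p) := by
      rw [fderiv_vert_eq_sum, ← h2]
      refine Finset.sum_congr rfl fun k _ => ?_
      rw [dy_comp_flip]
      simp [fibreFlip_apply]
    rw [h1, ← fderiv_comp_flip, map_sub, map_neg, map_smul, h3, smul_eq_mul]
    ring
  simp only [lnabla] at h0 ⊢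
  rw [hfld, hsum, hsum'] at h0
  linarith

lemma radial_of_sum_dy_mul {S : Set (Coord n × Coord n)} (hS : IsOpen S)
    {f : Coord n × Coord n → ℝ} (hf : ContDiffOn ℝ ∞ f S)
    (hsum : ∀ q ∈ S, ∑ i, dy i f q * q.2 i = f q) {p : Coord n × Coord n} (hp : p ∈ S)
    (i : Fin n) : ∑ k, dy i (dy k f) p * p.2 k = 0 := by
  have h1 : fderiv ℝ (fun q : Coord n × Coord n => ∑ k, dy k f q * q.2 k) p (0, stdVec i)
      = fderiv ℝ f p (0, stdVec i) := by
    rw [fderiv_congr_of_eqOn hS hsum hp]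
  rw [fderiv_sum_mul Finset.univ
    (fun k => smooth_differentiableAt hS (contDiffOn_dy hS hf k) hp)
    (fun k => differentiableAt_yCoord k p), Finset.sum_add_distrib] at h1
  simp only [fderiv_yCoord, stdVec_apply, mul_ite, mul_one, mul_zero, Finset.sum_ite_eq',
    Finset.mem_univ, if_true] at h1
  simp only [dy] at h1 ⊢
  linarith

/-- An even potential, homogeneous of degree one in the fibres, whose fibre Hessian is parallel for
a spray that is projectively its own reverse, satisfies the Euler-Lagrange equations. The
derivatives `∂Eᵢ/∂yʲ` of the Euler-Lagrange expressions are skew, hence constant along the fibres;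
they are odd, hence zero; and `Eᵢyⁱ = 0`. -/
lemma lEuler_eq_zero (hX : IsSecondOrder X S) (hflip : ∀ q ∈ S, fibreFlip n q ∈ S)
    (hfib : ∀ q ∈ S, ∀ y : Coord n, y ≠ 0 → (q.1, y) ∈ S) (hS0 : ∀ q ∈ S, q.2 ≠ 0) (hn : 2 ≤ n)
    {c : Coord n × Coord n → ℝ}
    (hXc : ∀ q ∈ S, (X (fibreFlip n q)).2 = (X q).2 + c q • q.2)
    (hf : ContDiffOn ℝ ∞ f S) (heven : ∀ q ∈ S, f (fibreFlip n q) = f q)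
    (hhom : ∀ q ∈ S, f q = ∑ i, dy i f q * q.2 i)
    (hpar : ∀ q ∈ S, ∀ i j, lnabla X (fun i j => dy i (dy j f)) i j q = 0) (hp : p ∈ S)
    (j : Fin n) : lEuler X f j p = 0 := by
  have hS := hX.isOpen
  have hE := contDiffOn_lEuler hX hf
  have hskew : ∀ q ∈ S, ∀ i j, dy j (lEuler X f i) q = -dy i (lEuler X f j) q := by
    intro q hq i j
    have := dy_lEuler_add hX hf hq i j
    rw [hpar q hq] at this
    linarith
  have hskew2 : ∀ q ∈ S, ∀ i j k,
      dy k (dy j (lEuler X f i)) q = -dy k (dy i (lEuler X f j)) q := by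
    intro q hq i j k
    have h1 := dy_congr hS (fun q hq => hskew q hq i j) hq k
    rw [h1, dy_neg]
  have hzero : ∀ q ∈ S, ∀ i j k, dy k (dy j (lEuler X f i)) q = 0 := by
    intro q hq i j k
    have a1 := hskew2 q hq i j k
    have a2 := dy_dy_comm hS (hE j) hq k i
    have a3 := hskew2 q hq j k i
    have a4 := dy_dy_comm hS (hE k) hq i j
    have a5 := hskew2 q hq k i j
    have a6 := dy_dy_comm hS (hE i) hq j k
    linarith
  have hconst : ∀ q ∈ S, ∀ i j, dy j (lEuler X f i) (fibreFlip n q) = dy j (lEuler X f i) q := by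
    intro q hq i j
    have hrank : 1 < Module.rank ℝ (Coord n) := by
      rw [rank_eq_card_basis (EuclideanSpace.basisFun (Fin n) ℝ).toBasis, Fintype.card_fin]
      exact_mod_cast hn
    have hcn := (isConnected_compl_singleton_of_one_lt_rank hrank (0 : Coord n)).isPreconnected
    have hder : ∀ y : Coord n, y ≠ 0 → HasFDerivAt (fun y => dy j (lEuler X f i) (q.1, y))
        ((fderiv ℝ (dy j (lEuler X f i)) (q.1, y)).comp
          (ContinuousLinearMap.inr ℝ (Coord n) (Coord n))) y := fun y hy =>
      (smooth_differentiableAt hS (contDiffOn_dy hS (hE i) j)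
        (hfib q hq y hy)).hasFDerivAt.comp y (hasFDerivAt_prodMk_right q.1 y)
    refine isOpen_compl_singleton.is_const_of_fderiv_eq_zero (𝕜 := ℝ)
      (f := fun y => dy j (lEuler X f i) (q.1, y)) hcn
      (fun y hy => (hder y hy).differentiableAt.differentiableWithinAt) (fun y hy => ?_)
      (neg_ne_zero.2 (hS0 q hq)) (hS0 q hq)
    rw [(hder y hy).fderiv]
    ext v
    have h1 := fderiv_vert_eq_sum (dy j (lEuler X f i)) (q.1, y) v
    simp only [hzero _ (hfib q hq y hy), mul_zero, Finset.sum_const_zero] at h1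
    exact h1
  have hodd : ∀ q ∈ S, ∀ i, dy i f (fibreFlip n q) = -dy i f q := by
    intro q hq i
    have h1 := dy_comp_flip f q i
    rw [dy_congr hS heven hq] at h1
    linarith
  have hrad : ∀ q ∈ S, ∀ i, ∑ k, q.2 k * dy k (dy i f) q = 0 := by
    intro q hq i
    rw [← radial_of_sum_dy_mul hS hf (fun q hq => (hhom q hq).symm) hq i]
    refine Finset.sum_congr rfl fun k _ => ?_
    rw [dy_dy_comm hS hf hq k i, mul_comm]
  have hevenE : ∀ q ∈ S, ∀ i, lEuler X f i (fibreFlip n q) = lEuler X f i q := by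
    intro q hq i
    have h1 : X (fibreFlip n q) = fibreFlip n (-X q - c q • ((0 : Coord n), q.2)) := by
      refine Prod.ext ?_ ?_
      · rw [hX.fst _ (hflip q hq)]
        simp [fibreFlip_apply, hX.fst _ hq]
      · rw [hXc q hq]
        simp [fibreFlip_apply, add_comm]
    have h2 : fderiv ℝ (fun q => dy i f (fibreFlip n q)) q = -fderiv ℝ (dy i f) q := by
      rw [fderiv_congr_of_eqOn (g := fun q => -dy i f q) hS (fun q hq => hodd q hq i) hq,
        fderiv_fun_neg]
    have h3 : dx i f (fibreFlip n q) = dx i f q := by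
      rw [← dx_comp_flip]
      simp only [dx, fderiv_congr_of_eqOn hS heven hq]
    simp only [lEuler]
    rw [h1, ← fderiv_comp_flip, h2, h3]
    simp only [neg_apply, map_sub, map_neg, map_smul]
    rw [fderiv_vert_eq_sum, hrad q hq i]
    simp
  have hdzero : ∀ q ∈ S, ∀ i j, dy j (lEuler X f i) q = 0 := by
    intro q hq i j
    have h1 := dy_comp_flip (lEuler X f i) q j
    rw [dy_congr hS (fun q hq => hevenE q hq i) hq, hconst q hq] at h1
    linarith
  have hsum : ∀ q ∈ S, ∑ i, lEuler X f i q * q.2 i = 0 := by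
    intro q hq
    have h1 : fderiv ℝ f q (X q)
        = fderiv ℝ (fun q : Coord n × Coord n => ∑ k, dy k f q * q.2 k) q (X q) := by
      rw [fderiv_congr_of_eqOn hS hhom hq]
    rw [fderiv_sum_mul Finset.univ
      (fun k => smooth_differentiableAt hS (contDiffOn_dy hS hf k) hq)
      (fun k => differentiableAt_yCoord k q), Finset.sum_add_distrib, fderiv_apply_eq_sum,
      hX.fst q hq] at h1
    simp only [fderiv_yCoord] at h1
    simp only [lEuler, sub_mul, Finset.sum_sub_distrib]
    have h2 : ∑ i, (X q).2 i * dy i f q = ∑ i, dy i f q * (X q).2 i :=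
      Finset.sum_congr rfl fun _ _ => mul_comm _ _
    have h3 : ∑ i, dx i f q * q.2 i = ∑ i, q.2 i * dx i f q :=
      Finset.sum_congr rfl fun _ _ => mul_comm _ _
    linarith
  have h1 : fderiv ℝ (fun q : Coord n × Coord n => ∑ k, lEuler X f k q * q.2 k) p (0, stdVec j)
      = 0 := by
    rw [fderiv_congr_of_eqOn (g := fun _ => 0) hS hsum hp]
    simp
  rw [fderiv_sum_mul Finset.univ (fun k => smooth_differentiableAt hS (hE k) hp)
      (fun k => differentiableAt_yCoord k p), Finset.sum_add_distrib] at h1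
  simp only [fderiv_yCoord, stdVec_apply, mul_ite, mul_one, mul_zero, Finset.sum_ite_eq',
    Finset.mem_univ, if_true] at h1
  have h2 : ∑ k, fderiv ℝ (lEuler X f k) p (0, stdVec j) * p.2 k = 0 :=
    Finset.sum_eq_zero fun k _ => by
      have := hdzero p hp k j
      simp only [dy] at this
      rw [this, zero_mul]
  rw [h2, zero_add] at h1
  exact h1

end Reversible

/-! ### The even potential of a fibre Hessian -/

section Arc

variable {V : Type*} [AddCommGroup V] [Module ℝ V]

/-- The half-ellipse from `y` (at `t = 0`) to `-y` (at `t = π`) through `w`. -/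
def arc (y w : V) (t : ℝ) : V := Real.cos t • y + Real.sin t • w

/-- The velocity of `arc`. -/
def arcDeriv (y w : V) (t : ℝ) : V := -Real.sin t • y + Real.cos t • w

lemma arc_ne_zero {y w : V} (h : LinearIndependent ℝ ![y, w]) (t : ℝ) : arc y w t ≠ 0 := by
  intro h0
  obtain ⟨h1, h2⟩ := LinearIndependent.pair_iff.1 h _ _ h0
  have := Real.sin_sq_add_cos_sq t
  rw [h1, h2] at this
  norm_num at this

lemma cos_smul_arc_sub (y w : V) (t : ℝ) :
    Real.cos t • arc y w t - Real.sin t • arcDeriv y w t = y := by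
  have h : y = (Real.sin t ^ 2 + Real.cos t ^ 2) • y := by
    rw [Real.sin_sq_add_cos_sq, one_smul]
  conv_rhs => rw [h]
  simp only [arc, arcDeriv]
  module

lemma arc_zero (y w : V) : arc y w 0 = y := by simp [arc]

lemma arc_pi (y w : V) : arc y w Real.pi = -y := by simp [arc]

lemma arc_neg_pi_sub (y w : V) (t : ℝ) : arc (-y) w (Real.pi - t) = arc y w t := by
  simp [arc]

lemma arcDeriv_neg_pi_sub (y w : V) (t : ℝ) :
    arcDeriv (-y) w (Real.pi - t) = -arcDeriv y w t := by
  simp only [arcDeriv, Real.sin_pi_sub, Real.cos_pi_sub]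
  module

lemma linearIndependent_neg_left {y w : V} (h : LinearIndependent ℝ ![y, w]) :
    LinearIndependent ℝ ![-y, w] := by
  rw [LinearIndependent.pair_iff] at h ⊢
  intro s t hst
  have := h (-s) t (by simpa using hst)
  exact ⟨neg_eq_zero.1 this.1, this.2⟩

lemma map_arc {V' : Type*} [AddCommGroup V'] [Module ℝ V'] (A : V →ₗ[ℝ] V') (y w : V) (t : ℝ) :
    A (arc y w t) = arc (A y) (A w) t := by
  simp [arc]

lemma map_arcDeriv {V' : Type*} [AddCommGroup V'] [Module ℝ V'] (A : V →ₗ[ℝ] V') (y w : V)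
    (t : ℝ) : A (arcDeriv y w t) = arcDeriv (A y) (A w) t := by
  simp [arcDeriv]

end Arc

lemma hasDerivAt_arc {n : ℕ} (y w : Coord n) (t : ℝ) :
    HasDerivAt (arc y w) (arcDeriv y w t) t :=
  ((Real.hasDerivAt_cos t).smul_const y).add ((Real.hasDerivAt_sin t).smul_const w)

lemma exists_linearIndependent_pair {n : ℕ} (hn : 2 ≤ n) {y : Coord n} (hy : y ≠ 0) :
    ∃ w, LinearIndependent ℝ ![y, w] := by
  have h : (Submodule.span ℝ {y}) ≠ ⊤ := by
    intro h
    have h1 := finrank_span_singleton (K := ℝ) hy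
    rw [h, finrank_top, finrank_euclideanSpace_fin] at h1
    omega
  obtain ⟨w, -, hw⟩ := SetLike.exists_of_lt (lt_top_iff_ne_top.2 h)
  refine ⟨w, (LinearIndependent.pair_iff' hy).2 fun a ha => hw ?_⟩
  exact ha ▸ Submodule.smul_mem _ _ (Submodule.mem_span_singleton_self y)

lemma isPreconnected_linearIndependent_pair {n : ℕ} (hn : 3 ≤ n) {y : Coord n} (hy : y ≠ 0) :
    IsPreconnected {w : Coord n | LinearIndependent ℝ ![y, w]} := by
  have h : {w : Coord n | LinearIndependent ℝ ![y, w]}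
      = ((Submodule.span ℝ {y} : Submodule ℝ (Coord n)) : Set (Coord n))ᶜ := by
    ext w
    simp only [mem_ofPred_eq, LinearIndependent.pair_iff' hy, mem_compl_iff, SetLike.mem_coe,
      Submodule.mem_span_singleton, not_exists]
  rw [h]
  refine (isConnected_compl_of_one_lt_codim ?_).isPreconnected
  have h1 := finrank_span_singleton (K := ℝ) hy
  have h2 := Submodule.finrank_quotient_add_finrank (Submodule.span ℝ {y})
  rw [h1, finrank_euclideanSpace_fin] at h2
  rw [← Module.finrank_eq_rank]
  exact_mod_cast (by omega : 1 < Module.finrank ℝ (Coord n ⧸ Submodule.span ℝ {y}))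

section Potential

variable {n : ℕ} {S : Set (Coord n × Coord n)}
  {h : Fin n → Fin n → Coord n × Coord n → ℝ}

/-- The integrand of `angularForm`. -/
def angularIntegrand (h : Fin n → Fin n → Coord n × Coord n → ℝ) (i : Fin n)
    (z : Coord n × Coord n × Coord n) (t : ℝ) : ℝ :=
  ∑ j, h i j (z.1, arc z.2.1 z.2.2 t) * arcDeriv z.2.1 z.2.2 t j

/-- The line integral of the fibre one-form `hᵢⱼ dyʲ` along the half-ellipse from `-y` to `y`
through `w`, as a function of `(x, y, w)`. -/
def angularForm (h : Fin n → Fin n → Coord n × Coord n → ℝ) (i : Fin n)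
    (z : Coord n × Coord n × Coord n) : ℝ :=
  -∫ t in (0 : ℝ)..Real.pi, angularIntegrand h i z t

/-- The weighted energy of the half-ellipse from `y` to `-y` through `w`, as a function
of `(x, y, w)`. -/
def arcEnergy (h : Fin n → Fin n → Coord n × Coord n → ℝ)
    (z : Coord n × Coord n × Coord n) : ℝ :=
  ∫ t in (0 : ℝ)..Real.pi, Real.sin t * ∑ i, ∑ j, h i j (z.1, arc z.2.1 z.2.2 t)
    * arcDeriv z.2.1 z.2.2 t i * arcDeriv z.2.1 z.2.2 t j

/-- The triples `(x, y, w)` with `(x, y) ∈ S` and `y, w` linearly independent. -/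
def arcDomain (S : Set (Coord n × Coord n)) : Set (Coord n × Coord n × Coord n) :=
  {z | (z.1, z.2.1) ∈ S ∧ LinearIndependent ℝ ![z.2.1, z.2.2]}

lemma isOpen_linearIndependent_pair :
    IsOpen {v : Coord n × Coord n | LinearIndependent ℝ ![v.1, v.2]} := by
  have h : IsOpen {f : Fin 2 → Coord n | LinearIndependent ℝ f} :=
    isOpen_setOfPred_linearIndependent
  refine h.preimage (f := fun v : Coord n × Coord n => ![v.1, v.2]) ?_
  refine continuous_pi fun i => ?_
  fin_cases i
  · exact continuous_fst
  · exact continuous_snd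

lemma isOpen_arcDomain (hS : IsOpen S) : IsOpen (arcDomain S) :=
  (hS.preimage (f := fun z : Coord n × Coord n × Coord n => (z.1, z.2.1)) (by fun_prop)).inter
    (isOpen_linearIndependent_pair.preimage
      (f := fun z : Coord n × Coord n × Coord n => z.2) (by fun_prop))

lemma arc_mem (hfib : ∀ q ∈ S, ∀ y : Coord n, y ≠ 0 → (q.1, y) ∈ S)
    {z : Coord n × Coord n × Coord n} (hz : z ∈ arcDomain S) (t : ℝ) :
    (z.1, arc z.2.1 z.2.2 t) ∈ S :=
  hfib _ hz.1 _ (arc_ne_zero hz.2 t)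

lemma contDiff_arc_apply : ContDiff ℝ ∞
    (fun q : (Coord n × Coord n × Coord n) × ℝ => (q.1.1, arc q.1.2.1 q.1.2.2 q.2)) := by
  unfold arc
  have h1 : ContDiff ℝ ∞ Real.cos := Real.contDiff_cos
  have h2 : ContDiff ℝ ∞ Real.sin := Real.contDiff_sin
  fun_prop

lemma contDiff_arcDeriv_apply (j : Fin n) : ContDiff ℝ ∞
    (fun q : (Coord n × Coord n × Coord n) × ℝ => arcDeriv q.1.2.1 q.1.2.2 q.2 j) := by
  have h1 : ContDiff ℝ ∞ Real.cos := Real.contDiff_cos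
  have h2 : ContDiff ℝ ∞ Real.sin := Real.contDiff_sin
  have h3 : ContDiff ℝ ∞ (fun q : (Coord n × Coord n × Coord n) × ℝ =>
      arcDeriv q.1.2.1 q.1.2.2 q.2) := by
    unfold arcDeriv
    fun_prop
  exact (EuclideanSpace.proj (𝕜 := ℝ) j).contDiff.comp h3

lemma contDiffOn_angularIntegrand (hh : IsFibreHessian h S)
    (hfib : ∀ q ∈ S, ∀ y : Coord n, y ≠ 0 → (q.1, y) ∈ S) (i : Fin n) :
    ContDiffOn ℝ ∞ (fun q : (Coord n × Coord n × Coord n) × ℝ => angularIntegrand h i q.1 q.2)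
      (arcDomain S ×ˢ univ) :=
  ContDiffOn.sum fun j _ => ((hh.smooth i j).comp contDiff_arc_apply.contDiffOn
    fun q hq => arc_mem hfib hq.1 q.2).mul (contDiff_arcDeriv_apply j).contDiffOn

lemma contDiffOn_angularForm (hS : IsOpen S) (hh : IsFibreHessian h S)
    (hfib : ∀ q ∈ S, ∀ y : Coord n, y ≠ 0 → (q.1, y) ∈ S) (i : Fin n) :
    ContDiffOn ℝ ∞ (angularForm h i) (arcDomain S) :=
  (contDiffOn_parametric_integral (isOpen_arcDomain hS)
    (contDiffOn_angularIntegrand hh hfib i) _ _).neg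

/-- First variation of the line integral of the closed form `hᵢⱼ dyʲ`: only the end points
matter. -/
lemma fderiv_angularForm (hS : IsOpen S) (hh : IsFibreHessian h S)
    (hfib : ∀ q ∈ S, ∀ y : Coord n, y ≠ 0 → (q.1, y) ∈ S) (i : Fin n)
    {z : Coord n × Coord n × Coord n} (hz : z ∈ arcDomain S) (a b : Coord n) :
    fderiv ℝ (angularForm h i) z (0, a, b)
      = ∑ j, (h i j (z.1, z.2.1) + h i j (z.1, -z.2.1)) * a j := by
  obtain ⟨x, y, w⟩ := z
  have hΩ := isOpen_arcDomain hS
  have hI := contDiffOn_angularIntegrand hh hfib i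
  have hd := (hasFDerivAt_parametric_integral hΩ hI 0 Real.pi hz).neg.fderiv
  have hd' : fderiv ℝ (angularForm h i) (x, y, w) = _ := hd
  have hc : Continuous fun t => fderiv ℝ (fun z => angularIntegrand h i z t) (x, y, w) := by
    have := (contDiffOn_fderiv_param hΩ hI).continuousOn.comp_continuous
      (f := fun t : ℝ => ((x, y, w), t)) (by fun_prop) (fun t => ⟨hz, mem_univ t⟩)
    exact this
  rw [hd', neg_apply, ContinuousLinearMap.intervalIntegral_apply (hc.intervalIntegrable _ _)]
  have hmem := fun t => arc_mem hfib hz t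
  have hdh := fun t j => (smooth_differentiableAt hS (hh.smooth i j) (hmem t)).hasFDerivAt
  have hdz : ∀ t, fderiv ℝ (fun z => angularIntegrand h i z t) (x, y, w) (0, a, b)
      = ∑ j, (fderiv ℝ (h i j) (x, arc y w t) (0, arc a b t) * arcDeriv y w t j
        + h i j (x, arc y w t) * arcDeriv a b t j) := by
    intro t
    let A : (Coord n × Coord n × Coord n) →L[ℝ] Coord n × Coord n :=
      (ContinuousLinearMap.fst ℝ _ _).prod
        (Real.cos t • (ContinuousLinearMap.fst ℝ _ _).comp (ContinuousLinearMap.snd ℝ _ _)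
          + Real.sin t • (ContinuousLinearMap.snd ℝ _ _).comp (ContinuousLinearMap.snd ℝ _ _))
    let B : (Coord n × Coord n × Coord n) →L[ℝ] Coord n :=
      -Real.sin t • (ContinuousLinearMap.fst ℝ _ _).comp (ContinuousLinearMap.snd ℝ _ _)
          + Real.cos t • (ContinuousLinearMap.snd ℝ _ _).comp (ContinuousLinearMap.snd ℝ _ _)
    have h1 : ∀ j, HasFDerivAt (fun z : Coord n × Coord n × Coord n =>
        h i j (z.1, arc z.2.1 z.2.2 t)) ((fderiv ℝ (h i j) (x, arc y w t)).comp A) (x, y, w) :=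
      fun j => (hdh t j).comp (x, y, w) (f := A) A.hasFDerivAt
    have h2 : ∀ j, HasFDerivAt (fun z : Coord n × Coord n × Coord n => arcDeriv z.2.1 z.2.2 t j)
        ((EuclideanSpace.proj (𝕜 := ℝ) j).comp B) (x, y, w) :=
      fun j => ((EuclideanSpace.proj (𝕜 := ℝ) j).comp B).hasFDerivAt
    have h3 := (HasFDerivAt.fun_sum fun j (_ : j ∈ Finset.univ) => (h1 j).fun_mul (h2 j)).fderiv
    have h4 : fderiv ℝ (fun z => angularIntegrand h i z t) (x, y, w) = _ := h3
    rw [h4, sum_apply]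
    refine Finset.sum_congr rfl fun j _ => ?_
    simp only [add_apply, smul_apply, ContinuousLinearMap.comp_apply, smul_eq_mul]
    rw [add_comm, mul_comm (arcDeriv y w t j)]
    rfl
  have hdt : ∀ t, HasDerivAt (fun t => ∑ j, h i j (x, arc y w t) * arc a b t j)
      (∑ j, (fderiv ℝ (h i j) (x, arc y w t) (0, arcDeriv y w t) * arc a b t j
        + h i j (x, arc y w t) * arcDeriv a b t j)) t := by
    intro t
    refine HasDerivAt.fun_sum fun j _ => ?_
    have h1 : HasDerivAt (fun t => (x, arc y w t)) ((0 : Coord n), arcDeriv y w t) t :=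
      (hasDerivAt_const t x).prodMk (hasDerivAt_arc y w t)
    have h2 := (hdh t j).comp_hasDerivAt t h1
    have h3 : HasDerivAt (fun t => arc a b t j) (arcDeriv a b t j) t :=
      (EuclideanSpace.proj (𝕜 := ℝ) j).hasFDerivAt.comp_hasDerivAt t (hasDerivAt_arc a b t)
    exact h2.mul h3
  have heq : ∀ t, fderiv ℝ (fun z => angularIntegrand h i z t) (x, y, w) (0, a, b)
      = ∑ j, (fderiv ℝ (h i j) (x, arc y w t) (0, arcDeriv y w t) * arc a b t j
        + h i j (x, arc y w t) * arcDeriv a b t j) := by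
    intro t
    rw [hdz, Finset.sum_add_distrib, Finset.sum_add_distrib]
    congr 1
    simp only [fderiv_vert_eq_sum, Finset.sum_mul]
    rw [Finset.sum_comm]
    refine Finset.sum_congr rfl fun k _ => Finset.sum_congr rfl fun j _ => ?_
    rw [hh.closed _ (hmem t) i j k]
    ring
  rw [intervalIntegral.integral_eq_sub_of_hasDerivAt
    (f := fun t => ∑ j, h i j (x, arc y w t) * arc a b t j)
    (fun t _ => by rw [heq t]; exact hdt t)
    ((hc.clm_apply continuous_const).intervalIntegrable _ _)]
  simp only [arc_zero, arc_pi, PiLp.neg_apply, mul_neg, Finset.sum_neg_distrib, add_mul,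
    Finset.sum_add_distrib]
  ring

/-- In dimension at least three the vectors `w` independent of `y` form a connected set, so the
line integral does not depend on `w`. -/
lemma angularForm_eq (hn : 3 ≤ n) (hS : IsOpen S) (hh : IsFibreHessian h S)
    (hfib : ∀ q ∈ S, ∀ y : Coord n, y ≠ 0 → (q.1, y) ∈ S) (hS0 : ∀ q ∈ S, q.2 ≠ 0) (i : Fin n)
    {x y w w' : Coord n} (hxy : (x, y) ∈ S) (hw : LinearIndependent ℝ ![y, w])
    (hw' : LinearIndependent ℝ ![y, w']) :
    angularForm h i (x, y, w) = angularForm h i (x, y, w') := by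
  have hder : ∀ w, LinearIndependent ℝ ![y, w] →
      HasFDerivAt (fun w => angularForm h i (x, y, w)) (0 : Coord n →L[ℝ] ℝ) w := by
    intro w hw
    have hz : (x, y, w) ∈ arcDomain S := ⟨hxy, hw⟩
    have h1 := (((contDiffOn_angularForm hS hh hfib i).contDiffAt
      ((isOpen_arcDomain hS).mem_nhds hz)).differentiableAt (by simp)).hasFDerivAt
    have h2 : HasFDerivAt (fun w : Coord n => (x, y, w)) _ w :=
      (hasFDerivAt_prodMk_right (𝕜 := ℝ) x (y, w)).comp w (hasFDerivAt_prodMk_right (𝕜 := ℝ) y w)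
    refine (h1.comp w h2).congr_fderiv ?_
    ext b
    have h3 := fderiv_angularForm hS hh hfib i hz 0 b
    simp only [PiLp.zero_apply, mul_zero, Finset.sum_const_zero] at h3
    exact h3
  have ho : IsOpen {w : Coord n | LinearIndependent ℝ ![y, w]} :=
    isOpen_linearIndependent_pair.preimage (f := fun w : Coord n => (y, w)) (by fun_prop)
  exact ho.is_const_of_fderiv_eq_zero (𝕜 := ℝ) (f := fun w => angularForm h i (x, y, w))
    (isPreconnected_linearIndependent_pair hn (hS0 _ hxy))
    (fun w hw => (hder w hw).differentiableAt.differentiableWithinAt)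
    (fun w hw => (hder w hw).fderiv) hw hw'

lemma arcEnergy_eq_sum (hh : IsFibreHessian h S)
    (hfib : ∀ q ∈ S, ∀ y : Coord n, y ≠ 0 → (q.1, y) ∈ S)
    {z : Coord n × Coord n × Coord n} (hz : z ∈ arcDomain S) :
    arcEnergy h z = ∑ i, z.2.1 i * angularForm h i z := by
  have hI : ∀ i, Continuous fun t => angularIntegrand h i z t := fun i => by
    have := (contDiffOn_angularIntegrand hh hfib i).continuousOn.comp_continuous
      (f := fun t : ℝ => (z, t)) (by fun_prop) (fun t => ⟨hz, mem_univ t⟩)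
    exact this
  simp only [angularForm, mul_neg, ← intervalIntegral.integral_const_mul,
    ← intervalIntegral.integral_neg]
  have hI' : ∀ i, Continuous fun t => -(z.2.1 i * angularIntegrand h i z t) := fun i =>
    ((hI i).const_mul _).neg
  rw [← intervalIntegral.integral_finsetSum fun i _ => (hI' i).intervalIntegrable _ _]
  refine intervalIntegral.integral_congr fun t _ => ?_
  have hmem := arc_mem hfib hz t
  have hy := cos_smul_arc_sub z.2.1 z.2.2 t
  have hyi : ∀ i, z.2.1 i = Real.cos t * arc z.2.1 z.2.2 t i
      - Real.sin t * arcDeriv z.2.1 z.2.2 t i := fun i => by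
    conv_lhs => rw [← hy]
    rfl
  have hr : ∑ i, ∑ j, arc z.2.1 z.2.2 t i * (h i j (z.1, arc z.2.1 z.2.2 t)
      * arcDeriv z.2.1 z.2.2 t j) = 0 := by
    rw [Finset.sum_comm]
    refine Finset.sum_eq_zero fun j _ => ?_
    have h1 := hh.radial _ hmem j
    have h2 : ∑ i, arc z.2.1 z.2.2 t i * (h i j (z.1, arc z.2.1 z.2.2 t)
      * arcDeriv z.2.1 z.2.2 t j) = (∑ i, h j i (z.1, arc z.2.1 z.2.2 t)
        * arc z.2.1 z.2.2 t i) * arcDeriv z.2.1 z.2.2 t j := by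
      rw [Finset.sum_mul]
      refine Finset.sum_congr rfl fun i _ => ?_
      rw [hh.symm _ hmem j i]
      ring
    rw [h2]
    simp only at h1
    rw [h1, zero_mul]
  simp only [angularIntegrand, Finset.mul_sum]
  have h3 : ∀ i, -∑ j, z.2.1 i * (h i j (z.1, arc z.2.1 z.2.2 t) * arcDeriv z.2.1 z.2.2 t j)
      = ∑ j, Real.sin t * (h i j (z.1, arc z.2.1 z.2.2 t) * arcDeriv z.2.1 z.2.2 t i
          * arcDeriv z.2.1 z.2.2 t j)
        - Real.cos t * ∑ j, arc z.2.1 z.2.2 t i * (h i j (z.1, arc z.2.1 z.2.2 t)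
      * arcDeriv z.2.1 z.2.2 t j) := fun i => by
    rw [← Finset.sum_neg_distrib, Finset.mul_sum, ← Finset.sum_sub_distrib]
    refine Finset.sum_congr rfl fun j _ => ?_
    rw [hyi i]
    ring
  rw [Finset.sum_congr rfl fun i _ => h3 i, Finset.sum_sub_distrib, ← Finset.mul_sum, hr]
  simp

lemma arcEnergy_eq (hn : 3 ≤ n) (hS : IsOpen S) (hh : IsFibreHessian h S)
    (hfib : ∀ q ∈ S, ∀ y : Coord n, y ≠ 0 → (q.1, y) ∈ S) (hS0 : ∀ q ∈ S, q.2 ≠ 0)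
    {x y w w' : Coord n} (hxy : (x, y) ∈ S) (hw : LinearIndependent ℝ ![y, w])
    (hw' : LinearIndependent ℝ ![y, w']) :
    arcEnergy h (x, y, w) = arcEnergy h (x, y, w') := by
  have hz : (x, y, w) ∈ arcDomain S := ⟨hxy, hw⟩
  have hz' : (x, y, w') ∈ arcDomain S := ⟨hxy, hw'⟩
  rw [arcEnergy_eq_sum hh hfib hz, arcEnergy_eq_sum hh hfib hz']
  refine Finset.sum_congr rfl fun i _ => ?_
  rw [angularForm_eq hn hS hh hfib hS0 i hxy hw hw']

lemma arcEnergy_neg (h : Fin n → Fin n → Coord n × Coord n → ℝ) (x y w : Coord n) :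
    arcEnergy h (x, -y, w) = arcEnergy h (x, y, w) := by
  have h1 := intervalIntegral.integral_comp_sub_left (a := 0) (b := Real.pi)
    (fun t => Real.sin t * ∑ i, ∑ j, h i j (x, arc (-y) w t)
    * arcDeriv (-y) w t i * arcDeriv (-y) w t j) Real.pi
  simp only [sub_self, sub_zero] at h1
  simp only [arcEnergy]
  rw [← h1]
  simp only [arc_neg_pi_sub, arcDeriv_neg_pi_sub, Real.sin_pi_sub, PiLp.neg_apply, mul_neg,
    neg_mul, neg_neg]

end Potential

section ArcPotential

variable {n : ℕ} {S : Set (Coord n × Coord n)}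
  {h : Fin n → Fin n → Coord n × Coord n → ℝ} {f : Coord n × Coord n → ℝ} {p : Coord n × Coord n}

/-- `f(x, y)` is the weighted energy of every half-ellipse from `y` to `-y`. -/
def IsArcPotential (f : Coord n × Coord n → ℝ) (h : Fin n → Fin n → Coord n × Coord n → ℝ)
    (S : Set (Coord n × Coord n)) : Prop :=
  ∀ p ∈ S, ∀ w, LinearIndependent ℝ ![p.2, w] → f p = arcEnergy h (p.1, p.2, w)

/-- The coordinate domain over an open set, with the zero section removed. -/
structure IsSlit (S : Set (Coord n × Coord n)) : Prop where
  isOpen : IsOpen S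
  fibre : ∀ q ∈ S, ∀ y : Coord n, y ≠ 0 → (q.1, y) ∈ S
  ne_zero : ∀ q ∈ S, q.2 ≠ 0

lemma IsSlit.flip_mem (hS : IsSlit S) (hp : p ∈ S) : fibreFlip n p ∈ S :=
  hS.fibre p hp _ (neg_ne_zero.2 (hS.ne_zero p hp))

lemma IsArcPotential.eventuallyEq (hS : IsSlit S) (hh : IsFibreHessian h S)
    (hf : IsArcPotential f h S) (hp : p ∈ S) {w : Coord n} (hw : LinearIndependent ℝ ![p.2, w]) :
    ∀ᶠ q in 𝓝 p, (q ∈ S ∧ LinearIndependent ℝ ![q.2, w]) ∧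
      f q = ∑ i, angularForm h i (q.1, q.2, w) * q.2 i := by
  have ho : IsOpen {q : Coord n × Coord n | LinearIndependent ℝ ![q.2, w]} :=
    isOpen_linearIndependent_pair.preimage (f := fun q : Coord n × Coord n => (q.2, w))
      (by fun_prop)
  filter_upwards [hS.isOpen.mem_nhds hp, ho.mem_nhds hw] with q hq hqw
  have hz : (q.1, q.2, w) ∈ arcDomain S := ⟨hq, hqw⟩
  refine ⟨⟨hq, hqw⟩, ?_⟩
  rw [hf q hq w hqw, arcEnergy_eq_sum hh hS.fibre hz]
  exact Finset.sum_congr rfl fun i _ => mul_comm _ _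

lemma contDiffAt_angularForm_fixed (hS : IsSlit S) (hh : IsFibreHessian h S) (hp : p ∈ S)
    {w : Coord n} (hw : LinearIndependent ℝ ![p.2, w]) (i : Fin n) :
    ContDiffAt ℝ ∞ (fun q : Coord n × Coord n => angularForm h i (q.1, q.2, w)) p := by
  have hz : (p.1, p.2, w) ∈ arcDomain S := ⟨hp, hw⟩
  have h1 := (contDiffOn_angularForm hS.isOpen hh hS.fibre i).contDiffAt
    ((isOpen_arcDomain hS.isOpen).mem_nhds hz)
  have h2 : ContDiff ℝ ∞ (fun q : Coord n × Coord n => (q.1, q.2, w)) := by fun_prop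
  exact h1.comp p (f := fun q : Coord n × Coord n => (q.1, q.2, w)) h2.contDiffAt

lemma dy_angularForm_fixed (hS : IsSlit S) (hh : IsFibreHessian h S) (hp : p ∈ S)
    {w : Coord n} (hw : LinearIndependent ℝ ![p.2, w]) (i j : Fin n) :
    dy j (fun q : Coord n × Coord n => angularForm h i (q.1, q.2, w)) p
      = h i j p + h i j (fibreFlip n p) := by
  have hz : (p.1, p.2, w) ∈ arcDomain S := ⟨hp, hw⟩
  have h1 := (((contDiffOn_angularForm hS.isOpen hh hS.fibre i).contDiffAt
    ((isOpen_arcDomain hS.isOpen).mem_nhds hz)).differentiableAt (by simp)).hasFDerivAt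
  have h2 : HasFDerivAt (fun q : Coord n × Coord n => (q.1, q.2, w))
      ((ContinuousLinearMap.fst ℝ _ _).prod ((ContinuousLinearMap.snd ℝ _ _).prod 0)) p :=
    hasFDerivAt_fst.prodMk (hasFDerivAt_snd.prodMk (hasFDerivAt_const w p))
  have h3 := (h1.comp p h2).fderiv
  have h4 := congrArg (fun L => L (0, stdVec j)) h3
  refine h4.trans ?_
  have h5 := fderiv_angularForm hS.isOpen hh hS.fibre i hz (stdVec j) 0
  refine h5.trans ?_
  simp [stdVec_apply, fibreFlip_apply]

lemma IsArcPotential.contDiffOn (hn : 2 ≤ n) (hS : IsSlit S) (hh : IsFibreHessian h S)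
    (hf : IsArcPotential f h S) : ContDiffOn ℝ ∞ f S := by
  intro p hp
  obtain ⟨w, hw⟩ := exists_linearIndependent_pair hn (hS.ne_zero p hp)
  have h1 : ContDiffAt ℝ ∞ (fun q : Coord n × Coord n =>
      ∑ i, angularForm h i (q.1, q.2, w) * q.2 i) p :=
    ContDiffAt.sum fun i _ => (contDiffAt_angularForm_fixed hS hh hp hw i).mul
      (yCoord i).contDiff.contDiffAt
  refine (h1.congr_of_eventuallyEq ?_).contDiffWithinAt
  filter_upwards [hf.eventuallyEq hS hh hp hw] with q hq using hq.2

lemma radial_flip (hS : IsSlit S) (hh : IsFibreHessian h S) (hp : p ∈ S) (i : Fin n) :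
    ∑ j, h i j (fibreFlip n p) * p.2 j = 0 := by
  have h1 := hh.radial _ (hS.flip_mem hp) i
  simpa [fibreFlip_apply] using h1

lemma IsArcPotential.dy_eq (hS : IsSlit S) (hh : IsFibreHessian h S)
    (hf : IsArcPotential f h S) (hp : p ∈ S) {w : Coord n} (hw : LinearIndependent ℝ ![p.2, w])
    (i : Fin n) : dy i f p = angularForm h i (p.1, p.2, w) := by
  have h1 : fderiv ℝ f p
      = fderiv ℝ (fun q : Coord n × Coord n => ∑ i, angularForm h i (q.1, q.2, w) * q.2 i) p := by
    refine Filter.EventuallyEq.fderiv_eq ?_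
    filter_upwards [hf.eventuallyEq hS hh hp hw] with q hq using hq.2
  rw [dy, h1, fderiv_sum_mul Finset.univ
    (fun k => (contDiffAt_angularForm_fixed hS hh hp hw k).differentiableAt (by simp))
    (fun k => differentiableAt_yCoord k p), Finset.sum_add_distrib]
  simp only [fderiv_yCoord, stdVec_apply, mul_ite, mul_one, mul_zero, Finset.sum_ite_eq',
    Finset.mem_univ, if_true]
  have h2 : ∑ k, fderiv ℝ (fun q : Coord n × Coord n => angularForm h k (q.1, q.2, w)) p
      (0, stdVec i) * p.2 k = ∑ k, (h i k p * p.2 k + h i k (fibreFlip n p) * p.2 k) := by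
    refine Finset.sum_congr rfl fun k _ => ?_
    have h3 := dy_angularForm_fixed hS hh hp hw k i
    rw [dy] at h3
    rw [h3, hh.symm _ hp i k, hh.symm _ (hS.flip_mem hp) i k]
    ring
  rw [h2, Finset.sum_add_distrib, hh.radial p hp, radial_flip hS hh hp]
  simp

/-- The fibre Hessian of an arc potential is the even part of `h` (up to the factor two). -/
lemma IsArcPotential.dy_dy_eq (hn : 2 ≤ n) (hS : IsSlit S) (hh : IsFibreHessian h S)
    (hf : IsArcPotential f h S) (hp : p ∈ S) (i j : Fin n) :
    dy j (dy i f) p = h i j p + h i j (fibreFlip n p) := by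
  obtain ⟨w, hw⟩ := exists_linearIndependent_pair hn (hS.ne_zero p hp)
  rw [← dy_angularForm_fixed hS hh hp hw i j, dy, dy]
  congr 1
  refine Filter.EventuallyEq.fderiv_eq ?_
  filter_upwards [hf.eventuallyEq hS hh hp hw] with q hq
  exact hf.dy_eq hS hh hq.1.1 hq.1.2 i

lemma IsArcPotential.eq_sum (hn : 2 ≤ n) (hS : IsSlit S) (hh : IsFibreHessian h S)
    (hf : IsArcPotential f h S) (hp : p ∈ S) : f p = ∑ i, dy i f p * p.2 i := by
  obtain ⟨w, hw⟩ := exists_linearIndependent_pair hn (hS.ne_zero p hp)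
  rw [(hf.eventuallyEq hS hh hp hw).self_of_nhds.2]
  exact Finset.sum_congr rfl fun i _ => by rw [hf.dy_eq hS hh hp hw i]

lemma IsArcPotential.even (hn : 2 ≤ n) (hS : IsSlit S) (hf : IsArcPotential f h S) (hp : p ∈ S) :
    f (fibreFlip n p) = f p := by
  obtain ⟨w, hw⟩ := exists_linearIndependent_pair hn (hS.ne_zero p hp)
  rw [hf p hp w hw, hf _ (hS.flip_mem hp) w (linearIndependent_neg_left hw)]
  exact arcEnergy_neg h p.1 p.2 w

lemma IsArcPotential.pos (hn : 2 ≤ n) (hS : IsSlit S) (hh : IsFibreHessian h S)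
    (hq : ∀ p ∈ S, ∀ u : Coord n, 0 ≤ ∑ i, ∑ j, h i j p * u i * u j ∧
      (∑ i, ∑ j, h i j p * u i * u j = 0 → ∃ k : ℝ, u = k • p.2))
    (hf : IsArcPotential f h S) (hp : p ∈ S) : 0 < f p := by
  obtain ⟨w, hw⟩ := exists_linearIndependent_pair hn (hS.ne_zero p hp)
  have hz : (p.1, p.2, w) ∈ arcDomain S := ⟨hp, hw⟩
  have hmem := arc_mem hS.fibre hz
  rw [hf p hp w hw, arcEnergy]
  have hc : Continuous fun t => Real.sin t * ∑ i, ∑ j, h i j (p.1, arc p.2 w t)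
      * arcDeriv p.2 w t i * arcDeriv p.2 w t j := by
    have h1 : ∀ i j, Continuous fun t => h i j (p.1, arc p.2 w t) := fun i j =>
      (hh.smooth i j).continuousOn.comp_continuous (by unfold arc; fun_prop) hmem
    have h2 : ∀ i, Continuous fun t => arcDeriv p.2 w t i := fun i => by
      have h3 : Continuous (arcDeriv p.2 w) := by unfold arcDeriv; fun_prop
      exact (EuclideanSpace.proj (𝕜 := ℝ) i).continuous.comp h3
    exact Real.continuous_sin.mul (continuous_finsetSum _ fun i _ => continuous_finsetSum _
      fun j _ => ((h1 i j).mul (h2 i)).mul (h2 j))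
  refine intervalIntegral.intervalIntegral_pos_of_pos_on (hc.intervalIntegrable _ _) ?_ Real.pi_pos
  intro t ht
  refine mul_pos (Real.sin_pos_of_mem_Ioo ht) ?_
  obtain ⟨h1, h2⟩ := hq _ (hmem t) (arcDeriv p.2 w t)
  refine lt_of_le_of_ne h1 fun h0 => ?_
  -- The velocity is never proportional to the position: both would lie on the line through `y`.
  obtain ⟨k, hk⟩ := h2 h0.symm
  have hk' : arcDeriv p.2 w t = k • arc p.2 w t := hk
  have h3 : (-Real.sin t - k * Real.cos t) • p.2 + (Real.cos t - k * Real.sin t) • w = 0 := by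
    have h4 : (-Real.sin t - k * Real.cos t) • p.2 + (Real.cos t - k * Real.sin t) • w
        = arcDeriv p.2 w t - k • arc p.2 w t := by
      simp only [arc, arcDeriv]
      module
    rw [h4, hk', sub_self]
  obtain ⟨h5, h6⟩ := LinearIndependent.pair_iff.1 hw _ _ h3
  have h7 := Real.sin_sq_add_cos_sq t
  have h8 : Real.sin t ^ 2 + Real.cos t ^ 2 = 0 := by
    linear_combination Real.cos t * h6 - Real.sin t * h5
  rw [h7] at h8
  norm_num at h8

lemma IsArcPotential.smul (hn : 2 ≤ n) (hS : IsSlit S) (hh : IsFibreHessian h S)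
    (hf : IsArcPotential f h S) (hp : p ∈ S) {k : ℝ} (hk : 0 < k) :
    f (p.1, k • p.2) = k * f p := by
  have hmem : ∀ s ∈ Ioi (0 : ℝ), (p.1, s • p.2) ∈ S := fun s hs =>
    hS.fibre p hp _ (smul_ne_zero (ne_of_gt hs) (hS.ne_zero p hp))
  have hsm := hf.contDiffOn hn hS hh
  have hconst : ∀ i, dy i f (p.1, k • p.2) = dy i f p := by
    intro i
    have hder : ∀ s ∈ Ioi (0 : ℝ), HasDerivAt (fun s : ℝ => dy i f (p.1, s • p.2)) 0 s := by
      intro s hs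
      have h1 : HasDerivAt (fun s : ℝ => (p.1, s • p.2)) ((0 : Coord n), p.2) s := by
        simpa using (hasDerivAt_const s p.1).prodMk ((hasDerivAt_id s).smul_const p.2)
      have h2 := (smooth_differentiableAt hS.isOpen (contDiffOn_dy hS.isOpen hsm i)
        (hmem s hs)).hasFDerivAt.comp_hasDerivAt s h1
      refine h2.congr_deriv ?_
      rw [fderiv_vert_eq_sum]
      have h3 : ∑ j, dy j (dy i f) (p.1, s • p.2) * (s • p.2) j = 0 := by
        simp only [hf.dy_dy_eq hn hS hh (hmem s hs) i, add_mul, Finset.sum_add_distrib]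
        rw [hh.radial _ (hmem s hs) i, radial_flip hS hh (hmem s hs), add_zero]
      have h4 : s * ∑ j, p.2 j * dy j (dy i f) (p.1, s • p.2) = 0 := by
        rw [← h3, Finset.mul_sum]
        refine Finset.sum_congr rfl fun j _ => ?_
        simp only [PiLp.smul_apply, smul_eq_mul]
        ring
      exact (mul_eq_zero.1 h4).resolve_left (ne_of_gt hs)
    have h1 := isOpen_Ioi.is_const_of_deriv_eq_zero (isPreconnected_Ioi (a := (0 : ℝ)))
      (fun s hs => (hder s hs).differentiableAt.differentiableWithinAt)
      (fun s hs => (hder s hs).deriv) (mem_Ioi.2 hk) (mem_Ioi.2 one_pos)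
    simpa using h1
  rw [hf.eq_sum hn hS hh (hmem k hk), hf.eq_sum hn hS hh hp, Finset.mul_sum]
  refine Finset.sum_congr rfl fun i _ => ?_
  rw [hconst]
  simp only [PiLp.smul_apply, smul_eq_mul]
  ring

end ArcPotential

/-! ### Projective classes in canonical coordinates -/

section Global

variable {n : ℕ} {M : Type*} [TopologicalSpace M] [ChartedSpace (Coord n) M]
  [IsManifold (𝓡 n) ∞ M]

lemma isSlit_slitDomain (e : OpenPartialHomeomorph M (Coord n)) : IsSlit (slitDomain e) where
  isOpen := isOpen_slitDomain e
  fibre := fun _ hq _ hy => ⟨hq.1, hy⟩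
  ne_zero := fun _ hq => hq.2

lemma IsSpray.isSecondOrder {Γ : TMField n M} (hΓ : IsSpray Γ)
    {e : OpenPartialHomeomorph M (Coord n)} (he : e ∈ charts n M) :
    IsSecondOrder (localField e Γ) (slitDomain e) where
  isOpen := isOpen_slitDomain e
  smooth := contDiffOn_localField he hΓ
  fst := fun _ hp => localField_fst he hΓ hp

lemma IsMultiplier.isFibreHessian {Γ : TMField n M} {h : Tensor02 n M} (hm : IsMultiplier Γ h)
    {e : OpenPartialHomeomorph M (Coord n)} (he : e ∈ charts n M) :
    IsFibreHessian (comp e h) (slitDomain e) where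
  smooth := hm.smooth e he
  symm := hm.symm e he
  radial := hm.radial e he
  closed := hm.closed e he

lemma ProjEquiv.refl (Γ : TMField n M) : ProjEquiv Γ Γ := by
  refine ⟨fun _ => 0, contMDiffOn_const, fun v _ => ?_, fun v _ => ?_⟩
  · rw [mfderiv_const]
    rfl
  · rw [mul_zero, zero_smul, sub_zero]

lemma ProjEquiv.trans {Γ₁ Γ₂ Γ₃ : TMField n M} (h₁₂ : ProjEquiv Γ₁ Γ₂) (h₂₃ : ProjEquiv Γ₂ Γ₃) :
    ProjEquiv Γ₁ Γ₃ := by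
  obtain ⟨P, hP, hP', hP''⟩ := h₁₂
  obtain ⟨Q, hQ, hQ', hQ''⟩ := h₂₃
  refine ⟨fun v => P v + Q v, hP.add hQ, fun v hv => ?_, fun v hv => ?_⟩
  · have d1 := ((hP.contMDiffAt (isOpen_slit.mem_nhds hv)).mdifferentiableAt
      (by simp)).hasMFDerivAt
    have d2 := ((hQ.contMDiffAt (isOpen_slit.mem_nhds hv)).mdifferentiableAt
      (by simp)).hasMFDerivAt
    have h := (d1.add d2).mfderiv
    refine (congrArg (fun L => L (liouville n M v)) h).trans ?_
    exact congrArg₂ (fun a b : ℝ => a + b) (hP' v hv) (hQ' v hv)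
  · rw [hQ'' v hv, hP'' v hv, mul_add, add_smul]
    abel

/-- Two members of a projective class differ, in coordinates, by a multiple of `Δ`. -/
lemma exists_localField_eq_of_mem_projClass {Γ Γ₁ Γ₂ : TMField n M} (h₁ : Γ₁ ∈ projClass Γ)
    (h₂ : Γ₂ ∈ projClass Γ) {e : OpenPartialHomeomorph M (Coord n)} (he : e ∈ charts n M) :
    ∃ c : Coord n × Coord n → ℝ, ∀ p ∈ slitDomain e,
      localField e Γ₂ p = localField e Γ₁ p + c p • ((0 : Coord n), p.2) := by
  obtain ⟨-, P, -, -, hP⟩ := h₁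
  obtain ⟨-, Q, -, -, hQ⟩ := h₂
  refine ⟨fun p => 2 * localFun e P p - 2 * localFun e Q p, fun p hp => ?_⟩
  rw [localField_of_projEquiv he hP hp, localField_of_projEquiv he hQ hp, sub_smul]
  abel

/-- In coordinates, every member of the projective class of a reversible spray agrees with its
reverse up to a smooth multiple of `Δ`. -/
lemma exists_flip_factor {Γ Γ' : TMField n M} (hrev : IsReversible Γ) (hΓ' : Γ' ∈ projClass Γ)
    {e : OpenPartialHomeomorph M (Coord n)} (he : e ∈ charts n M) :
    ∃ c : Coord n × Coord n → ℝ, ContDiffOn ℝ ∞ c (slitDomain e) ∧ ∀ p ∈ slitDomain e,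
      (localField e Γ' (fibreFlip n p)).2 = (localField e Γ' p).2 + c p • p.2 := by
  obtain ⟨-, P, hPs, -, hP⟩ := hΓ'
  obtain ⟨Q, hQs, -, hQ⟩ := hrev
  have hPs' := contMDiffOn_slit_iff.1 hPs e he
  have hQs' := contMDiffOn_slit_iff.1 hQs e he
  have hS := isSlit_slitDomain e
  refine ⟨fun p => 2 * localFun e P p - 2 * localFun e Q p + 2 * localFun e P (fibreFlip n p), ?_,
    fun p hp => ?_⟩
  · have h1 : ContDiffOn ℝ ∞ (fun p => localFun e P (fibreFlip n p)) (slitDomain e) :=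
      hPs'.comp (fibreFlip n).contDiff.contDiffOn fun p hp => hS.flip_mem hp
    exact ((contDiffOn_const.mul hPs').sub (contDiffOn_const.mul hQs')).add
      (contDiffOn_const.mul h1)
  · have h1 := congrArg Prod.snd (localField_reverse he (Γ := Γ) hp.1)
    rw [localField_of_projEquiv he hQ hp] at h1
    rw [localField_of_projEquiv he hP hp, localField_of_projEquiv he hP (hS.flip_mem hp)]
    simp only [Prod.snd_sub, Prod.smul_snd] at h1 ⊢
    rw [← h1]
    simp only [fibreFlip_apply]
    module

lemma tensor_apply_eq_sum (e : OpenPartialHomeomorph M (Coord n)) (h : Tensor02 n M)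
    (p : Coord n × Coord n) (u v : Coord n) :
    h (param e p) (mfderiv 𝓘(ℝ, Coord n) (𝓡 n) e.symm p.1 u)
      (mfderiv 𝓘(ℝ, Coord n) (𝓡 n) e.symm p.1 v)
      = ∑ i, ∑ j, comp e h i j p * u i * v j := by
  let A : Coord n →ₗ[ℝ] TangentSpace (𝓡 n) (param e p).proj :=
    (mfderiv 𝓘(ℝ, Coord n) (𝓡 n) e.symm p.1).toLinearMap
  have hA : ∀ u : Coord n, A u = ∑ i, u i • A (stdVec i) := fun u => by
    conv_lhs => rw [← sum_smul_stdVec u]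
    rw [map_sum]
    exact Finset.sum_congr rfl fun i _ => map_smul A _ _
  change h (param e p) (A u) (A v) = _
  rw [hA u, hA v]
  simp only [map_sum, map_smul, LinearMap.sum_apply, LinearMap.smul_apply, smul_eq_mul,
    Finset.mul_sum]
  rw [Finset.sum_comm]
  refine Finset.sum_congr rfl fun i _ => Finset.sum_congr rfl fun j _ => ?_
  have : comp e h i j p = h (param e p) (A (stdVec i)) (A (stdVec j)) := rfl
  rw [this]
  ring

/-- Positive quasi-definiteness in coordinates. -/
lemma isPosQuasiDef_iff {h : Tensor02 n M} :
    IsPosQuasiDef h ↔ ∀ e ∈ charts n M, ∀ p ∈ slitDomain e, ∀ u : Coord n,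
      0 ≤ ∑ i, ∑ j, comp e h i j p * u i * u j ∧
        (∑ i, ∑ j, comp e h i j p * u i * u j = 0 → ∃ k : ℝ, u = k • p.2) := by
  constructor
  · intro hq e he p hp u
    obtain ⟨h1, h2⟩ := hq _ (param_mem_slit he hp) (mfderiv 𝓘(ℝ, Coord n) (𝓡 n) e.symm p.1 u)
    rw [tensor_apply_eq_sum] at h1 h2
    refine ⟨h1, fun h0 => ?_⟩
    obtain ⟨k, hk⟩ := h2 h0
    refine ⟨k, symm_mfderiv_injective he hp.1 (hk.trans ?_)⟩
    exact (map_smul (mfderiv 𝓘(ℝ, Coord n) (𝓡 n) e.symm p.1) k p.2).symm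
  · intro hq v hv u
    obtain ⟨e, he, p, hp, -, rfl⟩ := exists_chart_param hv
    obtain ⟨u, rfl⟩ := symm_mfderiv_surjective he hp.1 u
    obtain ⟨h1, h2⟩ := hq e he p hp u
    have h3 := tensor_apply_eq_sum e h p u u
    refine ⟨h1.trans_eq h3.symm, fun h0 => ?_⟩
    obtain ⟨k, rfl⟩ := h2 (h3.symm.trans h0)
    exact ⟨k, map_smul (mfderiv 𝓘(ℝ, Coord n) (𝓡 n) e.symm p.1) k p.2⟩

/-! ### The Finsler function of a multiplier -/

open Classical in
/-- The even, fibrewise homogeneous function with fibre Hessian `h(x, y) + h(x, -y)`: the weighted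
energy of any half-ellipse from `v` to `-v` in the tangent space. It vanishes on the zero
section, where no vector `w` is independent of `v`. -/
def arcPotential (h : Tensor02 n M) (v : TangentBundle (𝓡 n) M) : ℝ :=
  if H : ∃ w : TangentSpace (𝓡 n) v.proj, LinearIndependent ℝ ![v.snd, w] then
    ∫ t in (0 : ℝ)..Real.pi, Real.sin t *
      h ⟨v.proj, arc v.snd H.choose t⟩ (arcDeriv v.snd H.choose t) (arcDeriv v.snd H.choose t)
  else 0

lemma arcPotential_zero (h : Tensor02 n M) (x : M) :
    arcPotential h (⟨x, 0⟩ : TangentBundle (𝓡 n) M) = 0 := by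
  refine dif_neg ?_
  rintro ⟨w, hw⟩
  exact hw.ne_zero 0 rfl

lemma isArcPotential_localFun (hn : 3 ≤ n) {h : Tensor02 n M}
    {e : OpenPartialHomeomorph M (Coord n)} (he : e ∈ charts n M)
    (hh : IsFibreHessian (comp e h) (slitDomain e)) :
    IsArcPotential (localFun e (arcPotential h)) (comp e h) (slitDomain e) := by
  intro p hp w hw
  have hS := isSlit_slitDomain e
  let A : Coord n →ₗ[ℝ] TangentSpace (𝓡 n) (param e p).proj :=
    (mfderiv 𝓘(ℝ, Coord n) (𝓡 n) e.symm p.1).toLinearMap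
  have hAi : Function.Injective A := symm_mfderiv_injective he hp.1
  have hA : ∀ u v : Coord n, LinearIndependent ℝ ![u, v] ↔ LinearIndependent ℝ ![A u, A v] := by
    intro u v
    simp only [LinearIndependent.pair_iff, ← map_smul, ← map_add]
    simp only [map_eq_zero_iff A hAi]
  have H : ∃ w : TangentSpace (𝓡 n) (param e p).proj,
      LinearIndependent ℝ ![(param e p).snd, w] := ⟨A w, (hA p.2 w).1 hw⟩
  obtain ⟨w', hw'⟩ : ∃ w', A w' = H.choose := symm_mfderiv_surjective he hp.1 _
  have hH := H.choose_spec
  rw [← hw'] at hH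
  have hlin : LinearIndependent ℝ ![p.2, w'] := (hA p.2 w').2 hH
  rw [arcEnergy_eq hn hS.isOpen hh hS.fibre hS.ne_zero hp hw hlin]
  have h1 : localFun e (arcPotential h) p = ∫ t in (0 : ℝ)..Real.pi, Real.sin t *
      h ⟨(param e p).proj, arc (A p.2) H.choose t⟩ (arcDeriv (A p.2) H.choose t)
        (arcDeriv (A p.2) H.choose t) := dif_pos H
  rw [h1, arcEnergy]
  refine intervalIntegral.integral_congr fun t _ => ?_
  simp only
  congr 1
  rw [← hw', ← map_arc, ← map_arcDeriv]
  exact tensor_apply_eq_sum e h (p.1, arc p.2 w' t) _ _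

end Global

section Existence

variable {n : ℕ} {M : Type*} [TopologicalSpace M] [ChartedSpace (Coord n) M]
  [IsManifold (𝓡 n) ∞ M]

lemma sum_dy_mul_of_finsler {F : TangentBundle (𝓡 n) M → ℝ} (hF : IsFinsler F)
    {e : OpenPartialHomeomorph M (Coord n)} (he : e ∈ charts n M) {p : Coord n × Coord n}
    (hp : p ∈ slitDomain e) : ∑ i, dy i (localFun e F) p * p.2 i = localFun e F p := by
  have hsm := contMDiffOn_slit_iff.1 hF.smooth e he
  have h1 : HasDerivAt (fun s : ℝ => (p.1, s • p.2)) ((0 : Coord n), p.2) 1 := by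
    simpa using (hasDerivAt_const (1 : ℝ) p.1).prodMk ((hasDerivAt_id (1 : ℝ)).smul_const p.2)
  have hp1 : (p.1, (1 : ℝ) • p.2) = p := by rw [one_smul]
  have h2 : HasFDerivAt (localFun e F) (fderiv ℝ (localFun e F) p) (p.1, (1 : ℝ) • p.2) := by
    rw [hp1]
    exact (smooth_differentiableAt (isOpen_slitDomain e) hsm hp).hasFDerivAt
  have h3 := h2.comp_hasDerivAt (1 : ℝ) h1
  have h4 : HasDerivAt (fun s : ℝ => s * localFun e F p) (localFun e F p) 1 := by
    simpa using (hasDerivAt_id (1 : ℝ)).mul_const (localFun e F p)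
  have h5 : (localFun e F ∘ fun s : ℝ => (p.1, s • p.2)) =ᶠ[𝓝 1]
      fun s : ℝ => s * localFun e F p := by
    filter_upwards [lt_mem_nhds (one_pos (α := ℝ))] with s hs
    have h6 := hF.homog _ (param_mem_slit he hp) s hs
    refine Eq.trans ?_ h6
    exact congrArg F (Bundle.TotalSpace.ext rfl (heq_of_eq (map_smul _ _ _)))
  have h7 := h3.unique (h4.congr_of_eventuallyEq h5)
  rw [fderiv_vert_eq_sum] at h7
  rw [← h7]
  exact Finset.sum_congr rfl fun i _ => mul_comm _ _

lemma sum_sum_fundTensor (e : OpenPartialHomeomorph M (Coord n)) (F : TangentBundle (𝓡 n) M → ℝ)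
    (p : Coord n × Coord n) (u : Fin n → ℝ) :
    ∑ i, ∑ j, fundTensor e F i j p * u i * u j
      = localFun e F p * ∑ i, ∑ j, dy i (dy j (localFun e F)) p * u i * u j
        + (∑ i, dy i (localFun e F) p * u i) ^ 2 := by
  rw [sq, Finset.sum_mul_sum, Finset.mul_sum, ← Finset.sum_add_distrib]
  refine Finset.sum_congr rfl fun i _ => ?_
  rw [Finset.mul_sum, ← Finset.sum_add_distrib]
  refine Finset.sum_congr rfl fun j _ => ?_
  simp only [fundTensor]
  ring

/-- Two sprays satisfying the Euler-Lagrange equations of a Finsler function with quasi-definite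
fibre Hessian are projectively equivalent. -/
lemma projEquiv_of_eulerLagrange {F : TangentBundle (𝓡 n) M → ℝ} (hF : IsFinsler F)
    (hdeg : ∀ e ∈ charts n M, ∀ p ∈ slitDomain e, ∀ u : Coord n,
      (∀ i, ∑ j, u j * dy j (dy i (localFun e F)) p = 0) → ∃ k : ℝ, u = k • p.2)
    {Γ₁ Γ₂ : TMField n M} (h₁ : Γ₁ ∈ geodesicClass F) (h₂ : Γ₂ ∈ geodesicClass F) :
    ProjEquiv Γ₁ Γ₂ := by
  obtain ⟨hs₁, hE₁⟩ := h₁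
  obtain ⟨hs₂, hE₂⟩ := h₂
  let a : TangentBundle (𝓡 n) M → ℝ := fun v => mfderiv (𝓡 n).tangent 𝓘(ℝ, ℝ) F v (Γ₁ v)
  let b : TangentBundle (𝓡 n) M → ℝ := fun v => mfderiv (𝓡 n).tangent 𝓘(ℝ, ℝ) F v (Γ₂ v)
  let Q : TangentBundle (𝓡 n) M → ℝ := fun v => (a v - b v) / (2 * F v)
  have hQ : ∀ e ∈ charts n M, ∀ p ∈ slitDomain e, localFun e Q p =
      (fderiv ℝ (localFun e F) p (localField e Γ₁ p)
        - fderiv ℝ (localFun e F) p (localField e Γ₂ p)) / (2 * localFun e F p) := by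
    intro e he p hp
    rw [fderiv_localFun he hF.smooth hp, fderiv_localFun he hF.smooth hp]
    rfl
  have hpos : ∀ e ∈ charts n M, ∀ p ∈ slitDomain e, 0 < localFun e F p := fun e he p hp =>
    hF.pos _ (param_mem_slit he hp)
  have hQs : ∀ e ∈ charts n M, ContDiffOn ℝ ∞ (localFun e Q) (slitDomain e) := by
    intro e he
    have hf := contMDiffOn_slit_iff.1 hF.smooth e he
    have ho := isOpen_slitDomain e
    exact (((contDiffOn_fderiv_apply ho hf (contDiffOn_localField he hs₁)).sub
      (contDiffOn_fderiv_apply ho hf (contDiffOn_localField he hs₂))).div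
      (contDiffOn_const.mul hf) fun p hp => by
        have := hpos e he p hp
        positivity).congr fun p hp => hQ e he p hp
  have hloc : ∀ e ∈ charts n M, ∀ p ∈ slitDomain e,
      localField e Γ₂ p = localField e Γ₁ p - (2 * localFun e Q p) • ((0 : Coord n), p.2) := by
    intro e he p hp
    have hf := contMDiffOn_slit_iff.1 hF.smooth e he
    set D : Coord n := (localField e Γ₂ p).2 - (localField e Γ₁ p).2 with hD
    have h3 : localField e Γ₂ p - localField e Γ₁ p = (0, D) :=
      Prod.ext (by simp [localField_fst he hs₁ hp, localField_fst he hs₂ hp]) rfl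
    obtain ⟨k, hk⟩ := hdeg e he p hp D fun i => by
      have h4 := hE₁ e he p hp i
      have h5 := hE₂ e he p hp i
      rw [← fderiv_vert_eq_sum, ← h3, map_sub]
      linarith
    have h6 : localFun e Q p = -(k / 2) := by
      have h7 : fderiv ℝ (localFun e F) p (localField e Γ₂ p)
          - fderiv ℝ (localFun e F) p (localField e Γ₁ p) = k * localFun e F p := by
        rw [← map_sub, h3, fderiv_vert_eq_sum, hk, ← sum_dy_mul_of_finsler hF he hp,
          Finset.mul_sum]
        refine Finset.sum_congr rfl fun i _ => ?_
        simp only [PiLp.smul_apply, smul_eq_mul]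
        ring
      have h8 := (hpos e he p hp).ne'
      rw [hQ e he p hp]
      field_simp
      linarith
    rw [h6, sub_eq_iff_eq_add'.1 h3, hk]
    refine Prod.ext ?_ ?_
    · simp
    · simp only [Prod.snd_add, Prod.snd_sub, Prod.smul_snd]
      module
  refine ⟨Q, contMDiffOn_slit_iff.2 hQs, fun v hv => ?_, fun v hv => ?_⟩
  · obtain ⟨e, he, p, hp, -, rfl⟩ := exists_chart_param hv
    rw [← fderiv_localFun he (contMDiffOn_slit_iff.2 hQs) hp, localField_liouville he hp.1]
    change _ = localFun e Q p
    have ho := isOpen_slitDomain e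
    -- Both sprays are homogeneous of degree two, so their difference `-2QΔ` is.
    have hdeg2 : ∀ Γ : TMField n M, IsSpray Γ →
        (fderiv ℝ (localField e Γ) p (0, p.2)).2 = (2 : ℝ) • (localField e Γ p).2 := by
      intro Γ hΓ
      have h1 := lieBracket_localField he hΓ hp
      have h2 : HasFDerivAt (fun q : Coord n × Coord n => ((0 : Coord n), q.2))
          ((0 : (Coord n × Coord n) →L[ℝ] Coord n).prod (ContinuousLinearMap.snd ℝ _ _)) p :=
        (hasFDerivAt_const _ p).prodMk hasFDerivAt_snd
      rw [VectorField.lieBracket, h2.fderiv] at h1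
      have h3 := congrArg Prod.snd h1
      simp only [Prod.snd_sub, ContinuousLinearMap.prod_apply, ContinuousLinearMap.coe_snd'] at h3
      rw [sub_eq_iff_eq_add] at h3
      rw [h3, two_smul]
    have d1 := smooth_differentiableAt ho (contDiffOn_localField he hs₁) hp
    have d2 := smooth_differentiableAt ho (hQs e he) hp
    have h1 : fderiv ℝ (localField e Γ₂) p = fderiv ℝ (fun q => localField e Γ₁ q
        - (2 * localFun e Q q) • ((0 : Coord n), q.2)) p :=
      fderiv_congr_of_eqOn ho (hloc e he) hp
    have h2 : HasFDerivAt (fun q : Coord n × Coord n => ((0 : Coord n), q.2))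
        ((0 : (Coord n × Coord n) →L[ℝ] Coord n).prod (ContinuousLinearMap.snd ℝ _ _)) p :=
      (hasFDerivAt_const _ p).prodMk hasFDerivAt_snd
    rw [(d1.hasFDerivAt.fun_sub ((d2.hasFDerivAt.const_mul 2).fun_smul h2)).fderiv] at h1
    have h3 := congrArg (fun L => (L ((0 : Coord n), p.2)).2) h1
    simp only [sub_apply, add_apply, smul_apply, Prod.snd_sub, Prod.snd_add, Prod.smul_snd,
      ContinuousLinearMap.prod_apply, ContinuousLinearMap.coe_snd', hdeg2 _ hs₁, hdeg2 _ hs₂,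
      ContinuousLinearMap.smulRight_apply] at h3
    rw [hloc e he p hp] at h3
    simp only [Prod.snd_sub, Prod.smul_snd, smul_eq_mul] at h3
    have h4 : (fderiv ℝ (localFun e Q) p (0, p.2) - localFun e Q p) • p.2 = 0 := by
      have h5 : (2 : ℝ) • ((fderiv ℝ (localFun e Q) p (0, p.2) - localFun e Q p) • p.2) = 0 := by
        rw [← sub_eq_zero] at h3
        refine Eq.trans ?_ h3
        module
      exact (smul_eq_zero.1 h5).resolve_left two_ne_zero
    exact sub_eq_zero.1 ((smul_eq_zero.1 h4).resolve_right hp.2)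
  · obtain ⟨e, he, p, hp, -, rfl⟩ := exists_chart_param hv
    rw [← mfderiv_param_localField he Γ₂ hp.1, hloc e he p hp,
      ← mfderiv_param_localField he Γ₁ hp.1, ← mfderiv_param_localField he (liouville n M) hp.1,
      localField_liouville he hp.1]
    erw [map_sub, map_smul]
    rfl

/-- The even potential of a positive quasi-definite multiplier for a member of the projective
class of a reversible spray is an absolutely homogeneous Finsler function whose geodesic class is
that projective class. -/
theorem exists_finsler_of_multiplier (hn : 3 ≤ n) {Γ Γ' : TMField n M} (hrev : IsReversible Γ)
    (hΓ' : Γ' ∈ projClass Γ) {h : Tensor02 n M} (hm : IsMultiplier Γ' h) (hq : IsPosQuasiDef h) :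
    IsFinsler (arcPotential h) ∧ IsAbsHomogeneous (arcPotential h) ∧
      projClass Γ = geodesicClass (arcPotential h) := by
  have hn2 : 2 ≤ n := by omega
  have hS := fun e : OpenPartialHomeomorph M (Coord n) => isSlit_slitDomain e
  have hh := fun e (he : e ∈ charts n M) => hm.isFibreHessian he
  have hA := fun e (he : e ∈ charts n M) => isArcPotential_localFun hn he (hh e he)
  have hq' := isPosQuasiDef_iff.1 hq
  have hsm := fun e (he : e ∈ charts n M) => (hA e he).contDiffOn hn2 (hS e) (hh e he)
  have hpos : ∀ v ∈ slit n M, 0 < arcPotential h v := by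
    intro v hv
    obtain ⟨e, he, p, hp, -, rfl⟩ := exists_chart_param hv
    exact (hA e he).pos hn2 (hS e) (hh e he) (hq' e he) hp
  have hsmul : ∀ v ∈ slit n M, ∀ k : ℝ, 0 < k →
      arcPotential h ⟨v.proj, k • v.snd⟩ = k * arcPotential h v := by
    intro v hv k hk
    obtain ⟨e, he, p, hp, -, rfl⟩ := exists_chart_param hv
    refine Eq.trans ?_ ((hA e he).smul hn2 (hS e) (hh e he) hp hk)
    exact congrArg (arcPotential h) (Bundle.TotalSpace.ext rfl (heq_of_eq (map_smul _ _ _).symm))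
  have hneg : ∀ v ∈ slit n M, arcPotential h ⟨v.proj, -v.snd⟩ = arcPotential h v := by
    intro v hv
    obtain ⟨e, he, p, hp, -, rfl⟩ := exists_chart_param hv
    refine Eq.trans ?_ ((hA e he).even hn2 (hS e) hp)
    exact congrArg (arcPotential h) (reflection_param e p)
  have hquad : ∀ e (he : e ∈ charts n M), ∀ p ∈ slitDomain e, ∀ u : Coord n,
      ∑ i, ∑ j, dy i (dy j (localFun e (arcPotential h))) p * u i * u j
        = ∑ i, ∑ j, comp e h i j p * u i * u j
          + ∑ i, ∑ j, comp e h i j (fibreFlip n p) * u i * u j := by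
    intro e he p hp u
    rw [← Finset.sum_add_distrib]
    refine Finset.sum_congr rfl fun i _ => ?_
    rw [← Finset.sum_add_distrib]
    refine Finset.sum_congr rfl fun j _ => ?_
    rw [dy_dy_comm (hS e).isOpen (hsm e he) hp, (hA e he).dy_dy_eq hn2 (hS e) (hh e he) hp]
    ring
  have hdef : ∀ e (he : e ∈ charts n M), ∀ p ∈ slitDomain e, ∀ u : Coord n,
      0 ≤ ∑ i, ∑ j, dy i (dy j (localFun e (arcPotential h))) p * u i * u j ∧
      (∑ i, ∑ j, dy i (dy j (localFun e (arcPotential h))) p * u i * u j = 0 →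
        ∃ k : ℝ, u = k • p.2) := by
    intro e he p hp u
    obtain ⟨h1, h2⟩ := hq' e he p hp u
    have h3 := (hq' e he _ ((hS e).flip_mem hp) u).1
    rw [hquad e he p hp u]
    exact ⟨add_nonneg h1 h3, fun h0 => h2 (by linarith)⟩
  have hF : IsFinsler (arcPotential h) := by
    refine ⟨contMDiffOn_slit_iff.2 hsm, hpos, hsmul, fun e he p hp u hu => ?_⟩
    rw [sum_sum_fundTensor]
    have hfp : 0 < localFun e (arcPotential h) p := hpos _ (param_mem_slit he hp)
    obtain ⟨h1, h2⟩ := hdef e he p hp (WithLp.toLp 2 u)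
    rcases h1.lt_or_eq with h1 | h1
    · exact add_pos_of_pos_of_nonneg (mul_pos hfp h1) (sq_nonneg _)
    · obtain ⟨k, hk⟩ := h2 h1.symm
      have hui : ∀ i, u i = k * p.2 i := fun i => congrArg (fun w : Coord n => w i) hk
      have hk0 : k ≠ 0 := by
        rintro rfl
        exact hu (funext fun i => by simp [hui i])
      have h3 : ∑ i, dy i (localFun e (arcPotential h)) p * u i
          = k * localFun e (arcPotential h) p := by
        rw [(hA e he).eq_sum hn2 (hS e) (hh e he) hp, Finset.mul_sum]
        refine Finset.sum_congr rfl fun i _ => ?_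
        rw [hui i]
        ring
      rw [h3]
      have h4 : ∑ i, ∑ j, dy i (dy j (localFun e (arcPotential h))) p * u i * u j = 0 := h1.symm
      rw [h4, mul_zero, zero_add]
      positivity
  have hEL : EulerLagrange (arcPotential h) Γ' := by
    intro e he p hp i
    have hX := hΓ'.1.isSecondOrder he
    obtain ⟨c, hc, hXc⟩ := exists_flip_factor hrev hΓ' he
    refine lEuler_eq_zero hX (fun q hq => (hS e).flip_mem hq) (hS e).fibre (hS e).ne_zero hn2 hXc
      (hsm e he) (fun q hq => (hA e he).even hn2 (hS e) hq)
      (fun q hq => (hA e he).eq_sum hn2 (hS e) (hh e he) hq) (fun q hq i j => ?_) hp i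
    have h1 : lnabla (localField e Γ') (comp e h) i j q = 0 := hm.parallel e he q hq i j
    have h2 := lnabla_comp_flip hX (fun q hq => (hS e).flip_mem hq) hc hXc (hh e he)
      (fun q hq i j => hm.parallel e he q hq i j) hq i j
    have h3 : ∀ i j, EqOn (dy i (dy j (localFun e (arcPotential h))))
        (fun q => comp e h i j q + comp e h i j (fibreFlip n q)) (slitDomain e) := fun i j q hq => by
      rw [dy_dy_comm (hS e).isOpen (hsm e he) hq, (hA e he).dy_dy_eq hn2 (hS e) (hh e he) hq]
    have d1 := smooth_differentiableAt (hS e).isOpen ((hh e he).smooth i j) hq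
    have d2 : DifferentiableAt ℝ (fun q => comp e h i j (fibreFlip n q)) q :=
      (smooth_differentiableAt (hS e).isOpen ((hh e he).smooth i j)
        ((hS e).flip_mem hq)).comp q (fibreFlip n).differentiableAt
    simp only [lnabla] at h1 h2 ⊢
    rw [fderiv_congr_of_eqOn (hS e).isOpen (h3 i j) hq, fderiv_fun_add d1 d2, add_apply]
    simp only [h3 _ _ hq, mul_add, Finset.sum_add_distrib]
    linarith
  refine ⟨hF, fun v hv k => ?_, Set.Subset.antisymm ?_ ?_⟩
  · rcases lt_trichotomy k 0 with hk | rfl | hk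
    · have hv' : (⟨v.proj, -v.snd⟩ : TangentBundle (𝓡 n) M) ∈ slit n M := fun h0 =>
        hv (neg_eq_zero.1 h0)
      have h1 := hsmul _ hv' (-k) (neg_pos.2 hk)
      rw [hneg v hv] at h1
      rw [abs_of_neg hk, ← h1]
      simp only [neg_smul, smul_neg, neg_neg]
    · rw [zero_smul, arcPotential_zero, abs_zero, zero_mul]
    · rw [abs_of_pos hk]
      exact hsmul v hv k hk
  · intro Γ₂ hΓ₂
    refine ⟨hΓ₂.1, fun e he p hp i => ?_⟩
    obtain ⟨c, hc⟩ := exists_localField_eq_of_mem_projClass hΓ' hΓ₂ he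
    have h1 := radial_of_sum_dy_mul (hS e).isOpen (hsm e he)
      (fun q hq => sum_dy_mul_of_finsler hF he hq) hp i
    have h2 : fderiv ℝ (dy i (localFun e (arcPotential h))) p ((0 : Coord n), p.2) = 0 := by
      rw [fderiv_vert_eq_sum, ← h1]
      refine Finset.sum_congr rfl fun k _ => ?_
      rw [dy_dy_comm (hS e).isOpen (hsm e he) hp, mul_comm]
    rw [hc p hp, map_add, map_smul, h2, smul_zero, add_zero]
    exact hEL e he p hp i
  · intro Γ₂ hΓ₂
    refine ⟨hΓ₂.1, hΓ'.2.trans (projEquiv_of_eulerLagrange hF (fun e he p hp u hu => ?_)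
      ⟨hΓ'.1, hEL⟩ hΓ₂)⟩
    refine (hdef e he p hp u).2 ?_
    rw [Finset.sum_comm]
    refine Finset.sum_eq_zero fun j _ => ?_
    rw [← Finset.sum_mul, ← zero_mul (u j), ← hu j]
    congr 1
    exact Finset.sum_congr rfl fun i _ => mul_comm _ _

end Existence

/-! ### The fibre Hessian of a Finsler function -/

section Hessian

variable {n : ℕ} {M : Type*} [TopologicalSpace M] [ChartedSpace (Coord n) M]
  [IsManifold (𝓡 n) ∞ M]

/-- A continuous bilinear form as a bilinear form. -/
def bilinOfCLM (L : Coord n →L[ℝ] Coord n →L[ℝ] ℝ) : LinearMap.BilinForm ℝ (Coord n) :=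
  LinearMap.mk₂ ℝ (fun a b => L a b) (fun a a' b => by simp) (fun c a b => by simp)
    (fun a b b' => by simp) (fun c a b => by simp)

/-- The second derivative of `F` along the fibres of the tangent bundle. -/
def fibreHessian (F : TangentBundle (𝓡 n) M → ℝ) : Tensor02 n M := fun v =>
  bilinOfCLM (fderiv ℝ (fderiv ℝ fun w : Coord n => F (⟨v.proj, w⟩ : TangentBundle (𝓡 n) M)) v.snd)

lemma comp_fibreHessian {F : TangentBundle (𝓡 n) M → ℝ}
    (hF : ContMDiffOn (𝓡 n).tangent 𝓘(ℝ, ℝ) ∞ F (slit n M))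
    {e : OpenPartialHomeomorph M (Coord n)} (he : e ∈ charts n M) {p : Coord n × Coord n}
    (hp : p ∈ slitDomain e) (i j : Fin n) :
    comp e (fibreHessian F) i j p = dy i (dy j (localFun e F)) p := by
  obtain ⟨x, y⟩ := p
  have hf := contMDiffOn_slit_iff.1 hF e he
  have ho := isOpen_slitDomain e
  let A : Coord n ≃L[ℝ] Coord n := ((charts_mdifferentiable he).symm).mfderiv hp.1
  have hA : ∀ u : Coord n, A u = mfderiv 𝓘(ℝ, Coord n) (𝓡 n) e.symm x u := fun _ => rfl
  let G : Coord n → ℝ := fun w => F (⟨e.symm x, w⟩ : TangentBundle (𝓡 n) M)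
  have hGA : ∀ u : Coord n, G (A u) = localFun e F (x, u) := fun _ => rfl
  have hmem : ∀ u : Coord n, u ≠ 0 → (x, u) ∈ slitDomain e := fun u hu => ⟨hp.1, hu⟩
  have hfx : ∀ u : Coord n, u ≠ 0 → ∀ b, fderiv ℝ G (A u) (A b)
      = fderiv ℝ (localFun e F) (x, u) (0, b) := by
    intro u hu b
    have h1 : fderiv ℝ (G ∘ A) u = (fderiv ℝ G (A u)).comp (A : Coord n →L[ℝ] Coord n) :=
      A.comp_right_fderiv
    have h2 := ((smooth_differentiableAt ho hf (hmem u hu)).hasFDerivAt.comp u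
      (hasFDerivAt_prodMk_right (𝕜 := ℝ) x u)).fderiv
    have h3 : fderiv ℝ (G ∘ A) u = _ := h2
    rw [h1] at h3
    exact congrArg (fun L => L b) h3
  have hGs : DifferentiableAt ℝ (fderiv ℝ G) (A y) := by
    have h1 : ContDiffAt ℝ ∞ (fun u : Coord n => localFun e F (x, A.symm u)) (A y) := by
      have h2 : ContDiffAt ℝ ∞ (localFun e F) (x, A.symm (A y)) := by
        rw [A.symm_apply_apply]
        exact hf.contDiffAt (ho.mem_nhds hp)
      have h3 : ContDiff ℝ ∞ (fun u : Coord n => (x, A.symm u)) :=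
        contDiff_const.prodMk A.symm.contDiff
      exact h2.comp (A y) (f := fun u : Coord n => (x, A.symm u)) h3.contDiffAt
    have h4 : (fun u : Coord n => localFun e F (x, A.symm u)) = G := by
      funext u
      rw [← hGA, A.apply_symm_apply]
    rw [h4] at h1
    exact (h1.fderiv_right (m := 1) (WithTop.coe_le_coe.2 le_top)).differentiableAt (by simp)
  have h1 : comp e (fibreHessian F) i j (x, y)
      = fderiv ℝ (fderiv ℝ G) (A y) (A (stdVec i)) (A (stdVec j)) := rfl
  have h2 : HasFDerivAt (fun u : Coord n => fderiv ℝ G (A u) (A (stdVec j))) _ y :=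
    (ContinuousLinearMap.apply ℝ ℝ (A (stdVec j))).hasFDerivAt.comp y
      (hGs.hasFDerivAt.comp y A.hasFDerivAt)
  have h3 : HasFDerivAt (fun u : Coord n => dy j (localFun e F) (x, u))
      ((fderiv ℝ (dy j (localFun e F)) (x, y)).comp
        (ContinuousLinearMap.inr ℝ (Coord n) (Coord n))) y :=
    (smooth_differentiableAt ho (contDiffOn_dy ho hf j) hp).hasFDerivAt.comp y
      (hasFDerivAt_prodMk_right (𝕜 := ℝ) x y)
  have h4 : (fun u : Coord n => fderiv ℝ G (A u) (A (stdVec j))) =ᶠ[𝓝 y]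
      fun u : Coord n => dy j (localFun e F) (x, u) := by
    filter_upwards [isOpen_compl_singleton.mem_nhds hp.2] with u hu
    exact hfx u hu (stdVec j)
  have h5 := h2.unique (h3.congr_of_eventuallyEq h4)
  rw [h1]
  exact congrArg (fun L => L (stdVec i)) h5

/-- The fibre Hessian of a Finsler function is a multiplier for every spray satisfying the
Euler-Lagrange equations. -/
theorem isMultiplier_fibreHessian {F : TangentBundle (𝓡 n) M → ℝ} (hF : IsFinsler F)
    {Γ : TMField n M} (hΓ : Γ ∈ geodesicClass F) : IsMultiplier Γ (fibreHessian F) := by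
  have hsm := contMDiffOn_slit_iff.1 hF.smooth
  have ho := fun e : OpenPartialHomeomorph M (Coord n) => isOpen_slitDomain e
  have hc : ∀ e (_ : e ∈ charts n M) i j, EqOn (comp e (fibreHessian F) i j)
      (dy i (dy j (localFun e F))) (slitDomain e) := fun e he i j p hp =>
    comp_fibreHessian hF.smooth he hp i j
  have hrad : ∀ e (_ : e ∈ charts n M), ∀ p ∈ slitDomain e, ∀ i,
      ∑ j, comp e (fibreHessian F) i j p * p.2 j = 0 := by
    intro e he p hp i
    simp only [hc e he _ _ hp]
    exact radial_of_sum_dy_mul (ho e) (hsm e he) (fun q hq => sum_dy_mul_of_finsler hF he hq) hp i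
  have hE : ∀ e (_ : e ∈ charts n M), ∀ p ∈ slitDomain e, ∀ i,
      lEuler (localField e Γ) (localFun e F) i p = 0 := hΓ.2
  refine ⟨fun e he i j => ?_, fun e he p hp i j => ?_, hrad, fun e he p hp i j k => ?_,
    fun e he p hp i j => ?_, fun e he p hp i j => ?_⟩
  · exact (contDiffOn_dy (ho e) (contDiffOn_dy (ho e) (hsm e he) j) i).congr (hc e he i j)
  · rw [hc e he _ _ hp, hc e he _ _ hp, dy_dy_comm (ho e) (hsm e he) hp]
  · rw [dy_congr (ho e) (hc e he i j) hp, dy_congr (ho e) (hc e he i k) hp,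
      dy_congr (ho e) (fun q hq => dy_dy_comm (ho e) (hsm e he) hq i j) hp,
      dy_congr (ho e) (fun q hq => dy_dy_comm (ho e) (hsm e he) hq i k) hp,
      dy_dy_comm (ho e) (contDiffOn_dy (ho e) (hsm e he) i) hp]
  · have hX := hΓ.1.isSecondOrder he
    have h1 := dy_lEuler_add hX (hsm e he) hp i j
    have h2 : ∀ i j, dy j (lEuler (localField e Γ) (localFun e F) i) p = 0 := fun i j => by
      rw [dy_congr (g := fun _ => 0) (ho e) (fun q hq => hE e he q hq i) hp]
      simp [dy]
    rw [h2, h2] at h1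
    have h3 : nabla e Γ (fibreHessian F) i j p
        = lnabla (localField e Γ) (fun i j => dy i (dy j (localFun e F))) i j p := by
      simp only [nabla, lnabla]
      rw [fderiv_congr_of_eqOn (ho e) (hc e he i j) hp]
      simp only [hc e he _ _ hp]
      rfl
    rw [h3]
    linarith
  · have hX := hΓ.1.isSecondOrder he
    have h1 := hessian_riemann_symm hX (hsm e he) (hE e he) hp i j
    -- The trace and `ρ` terms of the Weyl tensor contribute symmetrically, respectively trivially.
    have h2 : ∀ i j, ∑ k, comp e (fibreHessian F) i k p * weyl e Γ k j p
        = ∑ k, dy i (dy k (localFun e F)) p * lriemann (localField e Γ) k j p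
          - riemannTrace e Γ p * comp e (fibreHessian F) i j p := by
      intro i j
      have h3 : ∀ k, comp e (fibreHessian F) i k p * weyl e Γ k j p
          = comp e (fibreHessian F) i k p * riemann e Γ k j p
            - (if k = j then riemannTrace e Γ p * comp e (fibreHessian F) i k p else 0)
            - rhoForm e Γ j p * (comp e (fibreHessian F) i k p * p.2 k) := by
        intro k
        simp only [weyl]
        split_ifs <;> ring
      simp only [h3, Finset.sum_sub_distrib, ← Finset.mul_sum, hrad e he p hp i, mul_zero, sub_zero,
        Finset.sum_ite_eq', Finset.mem_univ, if_true]
      simp only [hc e he _ _ hp]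
      rfl
    rw [h2, h2, h1, hc e he i j hp, hc e he j i hp, dy_dy_comm (ho e) (hsm e he) hp]

/-- Quasi-definiteness of the fibre Hessian: on the kernel of `dF` it is a positive multiple of the
fundamental tensor, and the radial direction complements that kernel. -/
theorem isPosQuasiDef_fibreHessian {F : TangentBundle (𝓡 n) M → ℝ} (hF : IsFinsler F) :
    IsPosQuasiDef (fibreHessian F) := by
  refine isPosQuasiDef_iff.2 fun e he p hp u => ?_
  have ho := isOpen_slitDomain e
  have hsm := contMDiffOn_slit_iff.1 hF.smooth e he
  have hfp : 0 < localFun e F p := hF.pos _ (param_mem_slit he hp)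
  have hsum := sum_dy_mul_of_finsler hF he hp
  have hrad := radial_of_sum_dy_mul ho hsm (fun q hq => sum_dy_mul_of_finsler hF he hq) hp
  set c : ℝ := (∑ i, dy i (localFun e F) p * u i) / localFun e F p with hcdef
  set u' : Coord n := u - c • p.2 with hu'
  have hu'i : ∀ i, u' i = u i - c * p.2 i := fun i => rfl
  have h1 : ∑ i, dy i (localFun e F) p * u' i = 0 := by
    simp only [hu'i, mul_sub, Finset.sum_sub_distrib]
    have h2 : ∑ i, dy i (localFun e F) p * (c * p.2 i) = c * localFun e F p := by
      rw [← hsum, Finset.mul_sum]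
      exact Finset.sum_congr rfl fun i _ => by ring
    rw [h2, hcdef]
    field_simp
    ring
  have hrad' : ∀ j, ∑ i, dy i (dy j (localFun e F)) p * p.2 i = 0 := fun j => by
    rw [← hrad j]
    exact Finset.sum_congr rfl fun i _ => by rw [dy_dy_comm ho hsm hp]
  have h3 : ∑ i, ∑ j, comp e (fibreHessian F) i j p * u i * u j
      = ∑ i, ∑ j, dy i (dy j (localFun e F)) p * u' i * u' j := by
    have h4 : ∀ i j, dy i (dy j (localFun e F)) p * u' i * u' j
        = comp e (fibreHessian F) i j p * u i * u j
          - c * u i * (dy i (dy j (localFun e F)) p * p.2 j)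
          - c * u' j * (dy i (dy j (localFun e F)) p * p.2 i) := fun i j => by
      rw [comp_fibreHessian hF.smooth he hp, hu'i, hu'i]
      ring
    simp only [h4, Finset.sum_sub_distrib, ← Finset.mul_sum, hrad, mul_zero,
      sub_zero]
    rw [Finset.sum_comm (f := fun i j => c * u' j * (dy i (dy j (localFun e F)) p * p.2 i))]
    simp only [← Finset.mul_sum, hrad', mul_zero, Finset.sum_const_zero, sub_zero]
  have h5 := sum_sum_fundTensor e F p u'
  rw [h1] at h5
  rw [h3]
  by_cases hz : u' = 0
  · refine ⟨by simp [hz], fun _ => ⟨c, sub_eq_zero.1 hz⟩⟩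
  · have h6 := hF.convex e he p hp u' fun h0 => hz (by ext i; exact congrFun h0 i)
    rw [h5] at h6
    have h7 := pos_of_mul_pos_right (by simpa using h6) hfp.le
    exact ⟨h7.le, fun h0 => absurd h0 h7.ne'⟩

end Hessian

end ProjFinsler

end

theorem mainTheorem3 (n : ℕ) (hn : 3 ≤ n) (M : Type*) [TopologicalSpace M] [T2Space M]
    [ParacompactSpace M] [ChartedSpace (EuclideanSpace ℝ (Fin n)) M] [IsManifold (𝓡 n) ∞ M]
    (Γ : ProjFinsler.TMField n M) (hΓ : ProjFinsler.IsSpray Γ)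
    (hrev : ProjFinsler.IsReversible Γ) :
    List.TFAE [
      ∃ F : TangentBundle (𝓡 n) M → ℝ,
        ProjFinsler.IsFinsler F ∧ ProjFinsler.IsAbsHomogeneous F ∧
          ProjFinsler.projClass Γ = ProjFinsler.geodesicClass F,
      ∃ h : ProjFinsler.Tensor02 n M,
        (∃ Γ' ∈ ProjFinsler.projClass Γ, ProjFinsler.IsMultiplier Γ' h) ∧
          ProjFinsler.IsPosQuasiDef h,
      ∃ h : ProjFinsler.Tensor02 n M,
        (∀ Γ' ∈ ProjFinsler.projClass Γ, ProjFinsler.IsMultiplier Γ' h) ∧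
          ProjFinsler.IsPosQuasiDef h] := by
  tfae_have 1 → 3 := by
    rintro ⟨F, hF, -, hclass⟩
    exact ⟨ProjFinsler.fibreHessian F, fun Γ' hΓ' => ProjFinsler.isMultiplier_fibreHessian hF (hclass ▸ hΓ'),
      ProjFinsler.isPosQuasiDef_fibreHessian hF⟩
  tfae_have 3 → 2 := by
    rintro ⟨h, hm, hq⟩
    have hmem : Γ ∈ ProjFinsler.projClass Γ := ⟨hΓ, ProjFinsler.ProjEquiv.refl Γ⟩
    exact ⟨h, ⟨Γ, hmem, hm Γ hmem⟩, hq⟩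
  tfae_have 2 → 1 := by
    rintro ⟨h, ⟨Γ', hΓ', hm⟩, hq⟩
    exact ⟨ProjFinsler.arcPotential h, ProjFinsler.exists_finsler_of_multiplier hn hrev hΓ' hm hq⟩
  tfae_finish
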